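/- Let $(\mathcal M,g_{ab})$ be a smooth 4-dimensional Lorentzian manifold (signature $+---$) with a spin structure, with spin metric $\epsilon_{AB}$, $g_{ab}=\epsilon_{AB}\bar\epsilon_{A'B'}$, and let $\nabla_{AA'}$ be the Levi-Civita connection acting on spinors. Let $\mathcal S_{k,l}$ ($k,l\ge 0$) be the space of smooth symmetric spinor fields $\phi_{A_1\dots A_kA'_1\dots A'_l}$ of valence $(k,l)$ on $\mathcal M$. For $\phi\in\mathcal S_{i,j}$, $\varphi\in\mathcal S_{k,l}$, $0\le m\le\min(i,k)$ and $0\le n\le\min(j,l)$, the symmetric product $\phi\overset{m,n}{\odot}\varphi\in\mathcal S_{i+k-2m,\,j+l-2n}$ is $$(\phi\overset{m,n}{\odot}\varphi)_{A_1\dots A_{i+k-2m}}^{A'_1\dots A'_{j+l-2n}}=\phi_{(A_1\dots A_{i-m}}^{(A'_1\dots A'_{j-n}|B_1\dots B_mB'_1\dots B'_n|}\,\varphi^{A'_{j-n+1}\dots A'_{j+l-2n})}_{A_{i-m+1}\dots A_{i+k-2m})B_1\dots B_mB'_1\dots B'_n},$$ where the free unprimed indices are symmetrized, the free primed indices are symmetrized,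 and indices are moved by $\xi_B=\xi^A\epsilon_{AB}$, $\xi^A=\epsilon^{AB}\xi_B$ and the conjugate rules. Treating $\nabla_{AA'}$ formally as a left factor of valence $(1,1)$ that differentiates the right factor, the fundamental spinor operators on $\mathcal S_{k,l}$ are $$\mathscr T\varphi=\nabla\overset{0,0}{\odot}\varphi,\qquad \mathscr C\varphi=\nabla\overset{0,1}{\odot}\varphi,\qquad \mathscr C^\dagger\varphi=\nabla\overset{1,0}{\odot}\varphi,\qquad \mathscr D\varphi=\nabla\overset{1,1}{\odot}\varphi,$$ with values in $\mathcal S_{k+1,l+1}$, $\mathcal S_{k+1,l-1}$, $\mathcal S_{k-1,l+1}$, $\mathcal S_{k-1,l-1}$ respectively. An operator or product whose required contractions are impossible is read as $0$; on the right-hand sides below such terms only occur with coefficient $0$. Then for all $\phi\in\mathcal S_{i,j}$, $\varphi\in\mathcal S_{k,l}$, $0\le m\le\min(i,k)$, $0\le n\le\min(j,l)$ the following Leibniz rules hold. (1) $$\begin{aligned}\mathscr T(\phi\overset{m,n}{\odot}\varphi)={}&(-1)^{m+n}\varphi\overset{m,n}{\odot}\mathscr T\phi+\tfrac{(-1)^{m+n}n}{j+1}\varphi\overset{m,n-1}{\odot}\mathscr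 C\phi+\tfrac{(-1)^{m+n}m}{i+1}\varphi\overset{m-1,n}{\odot}\mathscr C^\dagger\phi+\tfrac{(-1)^{m+n}mn}{(i+1)(j+1)}\varphi\overset{m-1,n-1}{\odot}\mathscr D\phi\\&+\phi\overset{m,n}{\odot}\mathscr T\varphi+\tfrac{n}{l+1}\phi\overset{m,n-1}{\odot}\mathscr C\varphi+\tfrac{m}{k+1}\phi\overset{m-1,n}{\odot}\mathscr C^\dagger\varphi+\tfrac{mn}{kl+k+l+1}\phi\overset{m-1,n-1}{\odot}\mathscr D\varphi.\end{aligned}$$ (2) If $j+l-2n\ge 1$, $$\begin{aligned}\mathscr C(\phi\overset{m,n}{\odot}\varphi)={}&\tfrac{(-1)^{m+n+1}(l-n)}{j+l-2n}\varphi\overset{m,n+1}{\odot}\mathscr T\phi+\tfrac{(-1)^{m+n}(j-n)(j+l-n+1)}{(j+1)(j+l-2n)}\varphi\overset{m,n}{\odot}\mathscr C\phi\\&+\tfrac{(-1)^{m+n+1}m(l-n)}{(i+1)(j+l-2n)}\varphi\overset{m-1,n+1}{\odot}\mathscr C^\dagger\phi+\tfrac{(-1)^{m+n}m(j-n)(j+l-n+1)}{(i+1)(j+1)(j+l-2n)}\varphi\overset{m-1,n}{\odot}\mathscr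 D\phi\\&-\tfrac{j-n}{j+l-2n}\phi\overset{m,n+1}{\odot}\mathscr T\varphi+\tfrac{(l-n)(j+l-n+1)}{(l+1)(j+l-2n)}\phi\overset{m,n}{\odot}\mathscr C\varphi\\&+\tfrac{m(-j+n)}{(k+1)(j+l-2n)}\phi\overset{m-1,n+1}{\odot}\mathscr C^\dagger\varphi+\tfrac{m(l-n)(j+l-n+1)}{(k+1)(l+1)(j+l-2n)}\phi\overset{m-1,n}{\odot}\mathscr D\varphi.\end{aligned}$$ (3) If $i+k-2m\ge 1$, $$\begin{aligned}\mathscr C^\dagger(\phi\overset{m,n}{\odot}\varphi)={}&\tfrac{(-1)^{m+n+1}(k-m)}{i+k-2m}\varphi\overset{m+1,n}{\odot}\mathscr T\phi+\tfrac{(-1)^{m+n+1}n(k-m)}{(j+1)(i+k-2m)}\varphi\overset{m+1,n-1}{\odot}\mathscr C\phi\\&+\tfrac{(-1)^{m+n}(i-m)(i+k-m+1)}{(i+1)(i+k-2m)}\varphi\overset{m,n}{\odot}\mathscr C^\dagger\phi+\tfrac{(-1)^{m+n}n(i-m)(i+k-m+1)}{(i+1)(j+1)(i+k-2m)}\varphi\overset{m,n-1}{\odot}\mathscr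 D\phi\\&-\tfrac{i-m}{i+k-2m}\phi\overset{m+1,n}{\odot}\mathscr T\varphi+\tfrac{n(-i+m)}{(l+1)(i+k-2m)}\phi\overset{m+1,n-1}{\odot}\mathscr C\varphi\\&+\tfrac{(k-m)(i+k-m+1)}{(k+1)(i+k-2m)}\phi\overset{m,n}{\odot}\mathscr C^\dagger\varphi+\tfrac{n(k-m)(i+k-m+1)}{(k+1)(l+1)(i+k-2m)}\phi\overset{m,n-1}{\odot}\mathscr D\varphi.\end{aligned}$$ (4) If $i+k-2m\ge 1$ and $j+l-2n\ge 1$, $$\begin{aligned}\mathscr D(\phi\overset{m,n}{\odot}\varphi)={}&\tfrac{(-1)^{m+n}(k-m)(l-n)}{(i+k-2m)(j+l-2n)}\varphi\overset{m+1,n+1}{\odot}\mathscr T\phi+\tfrac{(-1)^{m+n+1}(j-n)(k-m)(j+l-n+1)}{(j+1)(i+k-2m)(j+l-2n)}\varphi\overset{m+1,n}{\odot}\mathscr C\phi\\&+\tfrac{(-1)^{m+n+1}(i-m)(l-n)(i+k-m+1)}{(i+1)(i+k-2m)(j+l-2n)}\varphi\overset{m,n+1}{\odot}\mathscr C^\dagger\phi+\tfrac{(-1)^{m+n}(i-m)(j-n)(i+k-m+1)(j+l-n+1)}{(i+1)(j+1)(i+k-2m)(j+l-2n)}\varphi\overset{m,n}{\odot}\mathscr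 D\phi\\&+\tfrac{(i-m)(j-n)}{(i+k-2m)(j+l-2n)}\phi\overset{m+1,n+1}{\odot}\mathscr T\varphi+\tfrac{(-i+m)(l-n)(j+l-n+1)}{(l+1)(i+k-2m)(j+l-2n)}\phi\overset{m+1,n}{\odot}\mathscr C\varphi\\&+\tfrac{(j-n)(-k+m)(i+k-m+1)}{(k+1)(i+k-2m)(j+l-2n)}\phi\overset{m,n+1}{\odot}\mathscr C^\dagger\varphi+\tfrac{(k-m)(l-n)(i+k-m+1)(j+l-n+1)}{(k+1)(l+1)(i+k-2m)(j+l-2n)}\phi\overset{m,n}{\odot}\mathscr D\varphi.\end{aligned}$$ -/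

import Mathlib

open Bundle
open scoped Manifold ContDiff

noncomputable section

namespace SymSpin

/-! ### Pointwise algebra

`V` is a two-dimensional complex vector space (spin space). A spinor `φ_{A₁…A_k A'₁…A'_l}` is the
function `(s, t) ↦ φ_{A₁…A_k A'₁…A'_l} s₁^{A₁} ⋯ s_k^{A_k} t̄₁^{A'₁} ⋯ t̄_l^{A'_l}`, complex linear in
each of the `k` unprimed slots and conjugate linear in each of the `l` primed slots. -/

/-- Functions of `k` unprimed and `l` primed spin vectors. -/
abbrev RawSpinor (V : Type*) (k l : ℕ) : Type _ := (Fin k → V) → (Fin l → V) → ℂ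

/-- `f` is a symmetric spinor of valence `(k, l)`: linear and symmetric in the unprimed slots,
conjugate linear and symmetric in the primed slots. -/
structure IsSymSpinor {V : Type*} [AddCommGroup V] [Module ℂ V] {k l : ℕ}
    (f : RawSpinor V k l) : Prop where
  map_add : ∀ (a : Fin k → V) (b : Fin l → V) (r : Fin k) (s t : V),
    f (Function.update a r (s + t)) b = f (Function.update a r s) b + f (Function.update a r t) b
  map_smul : ∀ (a : Fin k → V) (b : Fin l → V) (r : Fin k) (c : ℂ) (s : V),
    f (Function.update a r (c • s)) b = c * f (Function.update a r s) b
  map_add' : ∀ (a : Fin k → V) (b : Fin l → V) (r : Fin l) (s t : V),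
    f a (Function.update b r (s + t)) = f a (Function.update b r s) + f a (Function.update b r t)
  map_smul' : ∀ (a : Fin k → V) (b : Fin l → V) (r : Fin l) (c : ℂ) (s : V),
    f a (Function.update b r (c • s)) = (starRingEnd ℂ) c * f a (Function.update b r s)
  symm : ∀ (a : Fin k → V) (b : Fin l → V) (σ : Equiv.Perm (Fin k)) (τ : Equiv.Perm (Fin l)),
    f (a ∘ σ) (b ∘ τ) = f a b

/-- Arguments of the left factor (`k` slots, the last `i` of them contracted): the slots are filled
with the first `k - i` free arguments, then with the contracted basis vectors. -/
def leftSlots {V : Type*} {p : ℕ} (k i : ℕ) (hp : k - i ≤ p) (free : Fin p → V)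
    (contr : Fin i → V) : Fin k → V := fun r =>
  if h : (r : ℕ) < k - i then free ⟨r, by omega⟩ else contr ⟨r - (k - i), by omega⟩

/-- Arguments of the right factor (`n` slots, the last `i` of them contracted): the slots are filled
with the last `n - i` of the `p` free arguments, then with the contracted basis vectors. -/
def rightSlots {V : Type*} {p : ℕ} (n i : ℕ) (hp : n - i ≤ p) (free : Fin p → V)
    (contr : Fin i → V) : Fin n → V := fun r =>
  if h : (r : ℕ) < n - i then free ⟨p - (n - i) + r, by omega⟩ else contr ⟨r - (n - i), by omega⟩

/-- Contraction of `i` unprimed and `j` primed index pairs followed by symmetrization. Here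
`T` has two groups of indices, of valence `(k, l)` and `(n, m)`; the last `i` unprimed and `j` primed
indices of the first group are raised and contracted with those of the second group, and all the
remaining unprimed, and primed, indices are symmetrized. The result has valence
`(p, q) = (k + n - 2 i, l + m - 2 j)`; when the contraction is impossible, i.e. `i > min(k, n)` or
`j > min(l, m)`, or when `(p, q)` is not that valence, the result is defined to be zero.

`e = (o, ι)` is a spin dyad with `ε(o, ι) = o_A ι^A = 1`, so that `ε^{BC} = o^B ι^C - ι^B o^C` and
`α^B β_B = ε^{BC} α_C β_B = α(ι) β(o) - α(o) β(ι)`, and likewise for primed indices. This bivector,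
hence the result for (conjugate-)linear `T`, does not depend on the normalized dyad. -/
def contractSym {V : Type*} (e : Fin 2 → V) {k l n m : ℕ} (i j p q : ℕ)
    (T : (Fin k → V) → (Fin l → V) → (Fin n → V) → (Fin m → V) → ℂ) : RawSpinor V p q :=
  open scoped Classical in
  if h : (i ≤ k ∧ i ≤ n ∧ p + 2 * i = k + n) ∧ (j ≤ l ∧ j ≤ m ∧ q + 2 * j = l + m) then
    fun a b =>
      ((p.factorial : ℂ) * (q.factorial : ℂ))⁻¹ *
        ∑ σ : Equiv.Perm (Fin p), ∑ τ : Equiv.Perm (Fin q),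
          ∑ β : Fin i → Fin 2, ∑ γ : Fin j → Fin 2,
            (∏ r, (-1 : ℂ) ^ (β r : ℕ)) * (∏ r, (-1 : ℂ) ^ (γ r : ℕ)) *
              T (leftSlots k i (by omega) (a ∘ σ) (fun r => e (1 - β r)))
                (leftSlots l j (by omega) (b ∘ τ) (fun r => e (1 - γ r)))
                (rightSlots n i (by omega) (a ∘ σ) (fun r => e (β r)))
                (rightSlots m j (by omega) (b ∘ τ) (fun r => e (γ r)))
  else 0

/-! ### Spacetimes with spin structure -/

/-- The model space `ℝ⁴`. -/
abbrev E4 : Type := EuclideanSpace ℝ (Fin 4)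

/-- The model spin space `ℂ²`. -/
abbrev C2 : Type := Fin 2 → ℂ

section

variable {M : Type*} [TopologicalSpace M] [ChartedSpace E4 M]

/-- A smooth metric of Lorentzian signature `(+,-,-,-)` on a 4-manifold. -/
structure LorentzMetric (M : Type*) [TopologicalSpace M] [ChartedSpace E4 M]
    [IsManifold 𝓘(ℝ, E4) ∞ M] where
  val : ∀ x : M, TangentSpace 𝓘(ℝ, E4) x →L[ℝ] TangentSpace 𝓘(ℝ, E4) x →L[ℝ] ℝ
  symm : ∀ (x : M) (v w : TangentSpace 𝓘(ℝ, E4) x), val x v w = val x w v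
  signature : ∀ x : M, ∃ b : Module.Basis (Fin 4) ℝ (TangentSpace 𝓘(ℝ, E4) x), ∀ μ ν : Fin 4,
    val x (b μ) (b ν) = if μ = ν then (if μ = 0 then 1 else -1) else 0
  contMDiff : ContMDiff 𝓘(ℝ, E4) (𝓘(ℝ, E4).prod 𝓘(ℝ, E4 →L[ℝ] E4 →L[ℝ] ℝ)) ∞
    (fun x => TotalSpace.mk' (E4 →L[ℝ] E4 →L[ℝ] ℝ) x (val x))

variable {S : M → Type*} [TopologicalSpace (TotalSpace C2 S)]
  [∀ x, AddCommGroup (S x)] [∀ x, Module ℂ (S x)] [∀ x, TopologicalSpace (S x)]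
  [FiberBundle C2 S]

/-- The section `s` of the spin bundle is smooth at `x`. -/
def SmoothAt (s : ∀ x, S x) (x : M) : Prop :=
  ContMDiffAt 𝓘(ℝ, E4) (𝓘(ℝ, E4).prod 𝓘(ℝ, C2)) ∞ (fun y => TotalSpace.mk' C2 y (s y)) x

/-- The section `s` of the spin bundle is (real) differentiable at `x`. -/
def DiffAt (s : ∀ x, S x) (x : M) : Prop :=
  MDifferentiableAt 𝓘(ℝ, E4) (𝓘(ℝ, E4).prod 𝓘(ℝ, C2)) (fun y => TotalSpace.mk' C2 y (s y)) x

variable [IsManifold 𝓘(ℝ, E4) ∞ M]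

/-- The vector field `X` is differentiable at `x`. -/
def VDiffAt (X : ∀ x : M, TangentSpace 𝓘(ℝ, E4) x) (x : M) : Prop :=
  MDifferentiableAt 𝓘(ℝ, E4) (𝓘(ℝ, E4).prod 𝓘(ℝ, E4))
    (fun y => (TotalSpace.mk' E4 y (X y) : TotalSpace E4 (TangentSpace 𝓘(ℝ, E4) : M → Type _))) x

/-- A spin structure on `(M, g)`, presented by its bundle `S` of spin vectors `s^A`
(complex rank two): a smooth complex symplectic form `ε_{AB}` on `S` (the spin metric) and a
soldering form identifying `S^A ⊗ S̄^{A'}` with complexified tangent vectors. The latter is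
given by `sigma x s t = Re (s^A t̄^{A'}) = (s^A t̄^{A'} + t^A s̄^{A'}) / 2`, a real vector; thus
`s^A t̄^{A'}` is the complex vector `sigma x s t - i sigma x (i s) t`. The last condition is
`g_{ab} = ε_{AB} ε̄_{A'B'}` on the null vectors `s^A s̄^{A'}`, `t^A t̄^{A'}`; by polarization it
determines `g` on all of `S ⊗ S̄` and makes the soldering form an isomorphism. -/
structure SpinStructure (g : LorentzMetric M) (S : M → Type*) [TopologicalSpace (TotalSpace C2 S)]
    [∀ x, AddCommGroup (S x)] [∀ x, Module ℂ (S x)] [∀ x, TopologicalSpace (S x)]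
    [FiberBundle C2 S] where
  eps : ∀ x, S x →ₗ[ℂ] S x →ₗ[ℂ] ℂ
  eps_self : ∀ x (s : S x), eps x s s = 0
  eps_nondegenerate : ∀ x, ∃ o ι : S x, eps x o ι = 1
  eps_smooth : ∀ (s t : ∀ x, S x) (x : M), SmoothAt s x → SmoothAt t x →
    ContMDiffAt 𝓘(ℝ, E4) 𝓘(ℝ, ℂ) ∞ (fun y => eps y (s y) (t y)) x
  sigma : ∀ x, S x →ₗ[ℝ] S x →ₗ[ℝ] TangentSpace 𝓘(ℝ, E4) x
  sigma_symm : ∀ x (s t : S x), sigma x s t = sigma x t s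
  sigma_I : ∀ x (s t : S x), sigma x (Complex.I • s) (Complex.I • t) = sigma x s t
  sigma_smooth : ∀ (s t : ∀ x, S x) (x : M), SmoothAt s x → SmoothAt t x →
    ContMDiffAt 𝓘(ℝ, E4) (𝓘(ℝ, E4).prod 𝓘(ℝ, E4)) ∞
      (fun y => (TotalSpace.mk' E4 y (sigma y (s y) (t y)) :
        TotalSpace E4 (TangentSpace 𝓘(ℝ, E4) : M → Type _))) x
  metric_eq : ∀ x (s t : S x), g.val x (sigma x s s) (sigma x t t) = ‖eps x s t‖ ^ 2

/-- The Levi-Civita connection of `(M, g)` together with its lift to the spin bundle: the torsion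
free metric connection `covT` on `TM` and the complex linear connection `covS` on `S` for which the
spin metric and the soldering form are parallel. In Mathlib's convention `covS s x v` is `∇_v s`
at `x`. -/
structure LeviCivita {g : LorentzMetric M} (𝔖 : SpinStructure g S)
    [∀ x, IsTopologicalAddGroup (S x)] [∀ x, ContinuousSMul ℝ (S x)] where
  covT : CovariantDerivative 𝓘(ℝ, E4) E4 (TangentSpace 𝓘(ℝ, E4) : M → Type _)
  torsion_free : ∀ (X Y : ∀ x : M, TangentSpace 𝓘(ℝ, E4) x) (x : M), VDiffAt X x → VDiffAt Y x →
    covT Y x (X x) - covT X x (Y x) = VectorField.mlieBracket 𝓘(ℝ, E4) X Y x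
  metric : ∀ (X Y : ∀ x : M, TangentSpace 𝓘(ℝ, E4) x) (x : M) (v : TangentSpace 𝓘(ℝ, E4) x),
    VDiffAt X x → VDiffAt Y x →
    mvfderiv 𝓘(ℝ, E4) (fun y => g.val y (X y) (Y y)) x v =
      g.val x (covT X x v) (Y x) + g.val x (X x) (covT Y x v)
  covS : CovariantDerivative 𝓘(ℝ, E4) C2 S
  map_I : ∀ (s : ∀ x, S x) (x : M) (v : TangentSpace 𝓘(ℝ, E4) x), DiffAt s x →
    covS (fun y => Complex.I • s y) x v = Complex.I • covS s x v
  eps_parallel : ∀ (s t : ∀ x, S x) (x : M) (v : TangentSpace 𝓘(ℝ, E4) x),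
    DiffAt s x → DiffAt t x →
    mvfderiv 𝓘(ℝ, E4) (fun y => 𝔖.eps y (s y) (t y)) x v =
      𝔖.eps x (covS s x v) (t x) + 𝔖.eps x (s x) (covS t x v)
  sigma_parallel : ∀ (s t : ∀ x, S x) (x : M) (v : TangentSpace 𝓘(ℝ, E4) x),
    DiffAt s x → DiffAt t x →
    covT (fun y => 𝔖.sigma y (s y) (t y)) x v =
      𝔖.sigma x (covS s x v) (t x) + 𝔖.sigma x (s x) (covS t x v)

/-! ### Spinor fields, symmetric products and fundamental operators -/

/-- Fields of functions of `k` unprimed and `l` primed spin vectors. -/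
abbrev RawField (S : M → Type*) (k l : ℕ) : Type _ := ∀ x, RawSpinor (S x) k l

/-- `φ` is a smooth symmetric spinor field of valence `(k, l)`, an element of `𝒮_{k,l}`. -/
structure IsSymSpinorField {k l : ℕ} (φ : RawField S k l) : Prop where
  isSymSpinor : ∀ x, IsSymSpinor (φ x)
  smooth : ∀ (a : Fin k → ∀ x, S x) (b : Fin l → ∀ x, S x) (x : M),
    (∀ r, SmoothAt (a r) x) → (∀ r, SmoothAt (b r) x) →
    ContMDiffAt 𝓘(ℝ, E4) 𝓘(ℝ, ℂ) ∞ (fun y => φ y (fun r => a r y) (fun r => b r y)) x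

/-- A normalized spin dyad `(o, ι)`, `ε(o, ι) = 1`, at each point. -/
def SpinStructure.dyad {g : LorentzMetric M} (𝔖 : SpinStructure g S) (x : M) : Fin 2 → S x :=
  ![(𝔖.eps_nondegenerate x).choose, (𝔖.eps_nondegenerate x).choose_spec.choose]

theorem SpinStructure.eps_dyad {g : LorentzMetric M} (𝔖 : SpinStructure g S) (x : M) :
    𝔖.eps x (𝔖.dyad x 0) (𝔖.dyad x 1) = 1 :=
  (𝔖.eps_nondegenerate x).choose_spec.choose_spec

/-- The symmetric product `φ ⊙^{i,j} ψ` of spinor fields of valence `(k, l)` and `(n, m)`: contraction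
of `i` unprimed and `j` primed indices, followed by symmetrization. The target valence is
`(p, q) = (k + n - 2 i, l + m - 2 j)` (inferred from the expected type); see `contractSym`. -/
def SpinStructure.prod {g : LorentzMetric M} (𝔖 : SpinStructure g S) {k l n m p q : ℕ} (i j : ℕ)
    (φ : RawField S k l) (ψ : RawField S n m) : RawField S p q := fun x =>
  contractSym (𝔖.dyad x) i j p q (fun a b c d => φ x a b * ψ x c d)

namespace LeviCivita

variable [∀ x, IsTopologicalAddGroup (S x)] [∀ x, ContinuousSMul ℝ (S x)]
  {g : LorentzMetric M} {𝔖 : SpinStructure g S} {k l : ℕ}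

/-- The covariant derivative `(∇_v φ)(a, b)` of a spinor field along a tangent vector `v` at `x`, by
the product rule: the spin vectors `a`, `b` at `x` are extended to sections of `S` smooth near
`x`. -/
def covDeriv (nab : LeviCivita 𝔖) (φ : RawField S k l) (x : M) (v : TangentSpace 𝓘(ℝ, E4) x) :
    RawSpinor (S x) k l := fun a b =>
  mvfderiv 𝓘(ℝ, E4) (fun y => φ y (fun r => FiberBundle.extend C2 (a r) y)
      (fun r => FiberBundle.extend C2 (b r) y)) x v
    - ∑ r, φ x (Function.update a r (nab.covS (FiberBundle.extend C2 (a r)) x v)) b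
    - ∑ r, φ x a (Function.update b r (nab.covS (FiberBundle.extend C2 (b r)) x v))

/-- `s^A t̄^{A'} ∇_{AA'} φ`, the derivative along the complex vector
`s^A t̄^{A'} = sigma s t - i sigma (i s) t`. -/
def spinDeriv (nab : LeviCivita 𝔖) (φ : RawField S k l) (x : M) (s t : S x) :
    RawSpinor (S x) k l := fun a b =>
  nab.covDeriv φ x (𝔖.sigma x s t) a b
    - Complex.I * nab.covDeriv φ x (𝔖.sigma x (Complex.I • s) t) a b

/-- The symmetric product `∇ ⊙^{i,j} φ` with the valence `(1, 1)` operator `∇_{AA'}` acting on `φ`. -/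
def nablaProd (nab : LeviCivita 𝔖) {p q : ℕ} (i j : ℕ) (φ : RawField S k l) : RawField S p q :=
  fun x => contractSym (𝔖.dyad x) i j p q
    (fun (a : Fin 1 → S x) (b : Fin 1 → S x) c d => nab.spinDeriv φ x (a 0) (b 0) c d)

/-- The twistor operator `𝒯 φ = ∇ ⊙^{0,0} φ`. -/
def twist (nab : LeviCivita 𝔖) (φ : RawField S k l) : RawField S (k + 1) (l + 1) :=
  nab.nablaProd 0 0 φ

/-- The curl operator `𝒞 φ = ∇ ⊙^{0,1} φ` (zero for `l = 0`). -/
def curl (nab : LeviCivita 𝔖) (φ : RawField S k l) : RawField S (k + 1) (l - 1) :=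
  nab.nablaProd 0 1 φ

/-- The curl-dagger operator `𝒞† φ = ∇ ⊙^{1,0} φ` (zero for `k = 0`). -/
def curlDagger (nab : LeviCivita 𝔖) (φ : RawField S k l) : RawField S (k - 1) (l + 1) :=
  nab.nablaProd 1 0 φ

/-- The divergence operator `𝒟 φ = ∇ ⊙^{1,1} φ` (zero for `k = 0` or `l = 0`). -/
def div (nab : LeviCivita 𝔖) (φ : RawField S k l) : RawField S (k - 1) (l - 1) :=
  nab.nablaProd 1 1 φ

end LeviCivita

end

end SymSpin

end

/-! The operators are contractions of `∇` applied to a product, so the proof splits into an analytic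
and an algebraic half.

Analytic half (`covDeriv_prod`, `spinDeriv_prod`): because `ε` is parallel, contraction commutes
with `∇`, so `∇` of a symmetric product is the sum of the products with one factor differentiated.
The delicate point is that the dyads entering the contractions are chosen point by point, without
any continuity. Near a given point the chosen dyad is therefore compared with a smooth extension of
its value there. The contraction changes by powers of the determinant `D` and its conjugate
(`contractSym_tensor_change_dyad`), and the derivative of `D` is a trace. The same trace appears
when the connection acts slot by slot on a contraction (`contractSym_slotDeriv`), and the two
contributions cancel.

Algebraic half (`derivProduct_eq`): it remains to rewrite a contraction of `∇` into the product `∇φ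
⊙ ψ` through the four irreducible parts of `∇φ`. Symmetric spinors are spanned by products of a
power of a linear form and a power of a conjugate linear form (`IsSymSpinor.mem_span`), and `∇φ` is
spanned by a covector of valence `(1, 1)` times such products. On these generators the unprimed and
primed contractions separate (`contractSym_tensor_outer`), so every coefficient is a product of one
unprimed and one primed coefficient, and only two identities for a single kind of index are needed:
symmetrize with a covector (`contract1_zero_contract1`), or contract with it
(`contract1_one_contract1`).

Both identities concern a covector `a` and powers of forms `f`, `g`. A symmetric form in two
dimensions is determined by its diagonal values (`eq_zero_of_diagonal`), where each term is a
monomial in `a s`, `f s`, `g s` and the brackets `f^A g_A`, `a^A f_A`, `a^A g_A`, or a sum of such.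
The identities then follow from `ε_{A[B} ε_{CD]} = 0`, that is, from `bracket_cyclic`. The terms
with the second factor differentiated follow by exchanging the factors, at the cost of the sign
`(-1)^(m+n)`. -/

noncomputable section

namespace SymSpin

/-! ### Forms in one kind of index

The ring homomorphism `ρ` is the identity for unprimed and complex conjugation for primed
indices. -/

section OneKind

variable {V : Type*} [AddCommGroup V] [Module ℂ V]

/-- `A` is semilinear along `ρ` in each of its slots. -/
structure IsSemiMultilinear (ρ : ℂ →+* ℂ) {k : ℕ} (A : (Fin k → V) → ℂ) : Prop where
  map_add : ∀ (a : Fin k → V) (r : Fin k) (s t : V),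
    A (Function.update a r (s + t)) = A (Function.update a r s) + A (Function.update a r t)
  map_smul : ∀ (a : Fin k → V) (r : Fin k) (c : ℂ) (s : V),
    A (Function.update a r (c • s)) = ρ c * A (Function.update a r s)

namespace IsSemiMultilinear

variable {ρ : ℂ →+* ℂ} {k : ℕ} {A B : (Fin k → V) → ℂ}

/-- The underlying additive multilinear map. -/
def toMultilinearMap (hA : IsSemiMultilinear ρ A) : MultilinearMap ℕ (fun _ : Fin k => V) ℂ where
  toFun := A
  map_update_add' := by
    intro _ a r s t
    convert hA.map_add a r s t
  map_update_smul' := by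
    intro _ a r c s
    -- The scalars are only `ℕ`: a ring homomorphism fixes natural numbers, so the twist by `ρ`
    -- disappears.
    have h := hA.map_smul a r (c : ℂ) s
    rw [Nat.cast_smul_eq_nsmul ℂ c s, map_natCast] at h
    rw [nsmul_eq_mul]
    convert h

theorem map_smul_univ (hA : IsSemiMultilinear ρ A) (c : Fin k → ℂ) (v : Fin k → V) :
    A (fun r => c r • v r) = (∏ r, ρ (c r)) * A v := by
  have key : ∀ s : Finset (Fin k),
      A (s.piecewise (fun r => c r • v r) v) = (∏ r ∈ s, ρ (c r)) * A v := by
    intro s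
    induction s using Finset.induction_on with
    | empty => simp
    | insert j s hj ih =>
      have hself : Function.update (s.piecewise (fun r => c r • v r) v) j (v j) =
          s.piecewise (fun r => c r • v r) v := by
        rw [Function.update_eq_self_iff]
        simp [hj]
      rw [Finset.piecewise_insert, hA.map_smul, hself, ih, Finset.prod_insert hj, mul_assoc]
  simpa using key Finset.univ

theorem map_sum_smul (hA : IsSemiMultilinear ρ A) (y : Fin 2 → Fin k → ℂ) (e : Fin 2 → V) :
    A (fun r => ∑ b, y b r • e b) = ∑ β : Fin k → Fin 2, (∏ r, ρ (y (β r) r)) * A (e ∘ β) := by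
  have h := hA.toMultilinearMap.map_sum (fun (r : Fin k) (b : Fin 2) => y b r • e b)
  refine h.trans (Finset.sum_congr rfl fun β _ => ?_)
  exact hA.map_smul_univ (fun r => y (β r) r) (fun r => e (β r))

theorem add (hA : IsSemiMultilinear ρ A) (hB : IsSemiMultilinear ρ B) :
    IsSemiMultilinear ρ (A + B) where
  map_add a r s t := by simp only [Pi.add_apply, hA.map_add, hB.map_add]; ring
  map_smul a r c s := by simp only [Pi.add_apply, hA.map_smul, hB.map_smul]; ring

theorem smul (c : ℂ) (hA : IsSemiMultilinear ρ A) : IsSemiMultilinear ρ (c • A) where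
  map_add a r s t := by simp only [Pi.smul_apply, hA.map_add, smul_eq_mul]; ring
  map_smul a r c s := by simp only [Pi.smul_apply, hA.map_smul, smul_eq_mul]; ring

end IsSemiMultilinear

/-! ### Polarization of symmetric forms on a two-dimensional space -/

theorem exists_perm_comp_eq_of_sum_eq {k : ℕ} (β β' : Fin k → Fin 2)
    (h : ∑ r, (β r : ℕ) = ∑ r, (β' r : ℕ)) : ∃ σ : Equiv.Perm (Fin k), β' ∘ σ = β := by
  have hval : ∀ γ : Fin k → Fin 2, ∑ r, (γ r : ℕ) = Fintype.card {r // γ r = 1} := by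
    intro γ
    rw [Fintype.card_subtype, Finset.card_filter]
    refine Finset.sum_congr rfl fun r _ => ?_
    generalize γ r = b
    fin_cases b <;> rfl
  rw [hval, hval] at h
  -- A bijection between the two sets of ones extends to a permutation of all slots.
  let E := Fintype.equivOfCardEq h
  refine ⟨E.extendSubtype, funext fun r => ?_⟩
  have h2 : ∀ b : Fin 2, b ≠ 1 → b = 0 := by decide
  by_cases hr : β r = 1
  · simpa [hr] using E.extendSubtype_mem r hr
  · have h1 := E.extendSubtype_not_mem r hr
    simp only [Function.comp_apply]
    rw [h2 _ hr, h2 _ h1]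

/-- The nodes `0, …, k` are distinct, so their Vandermonde matrix is invertible, and the rows of the
inverse recover the coefficients of a polynomial of degree at most `k` from its values. Natural
numbers are used as nodes because every `ρ` fixes them. -/
theorem exists_vandermonde_dual (k : ℕ) : ∃ c : Fin (k + 1) → Fin (k + 1) → ℂ,
    ∀ w v : Fin (k + 1), ∑ t, c w t * ((t : ℕ) : ℂ) ^ (v : ℕ) = if w = v then 1 else 0 := by
  let W : Matrix (Fin (k + 1)) (Fin (k + 1)) ℂ := Matrix.vandermonde fun t => ((t : ℕ) : ℂ)
  have hdet : IsUnit W.det := by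
    rw [isUnit_iff_ne_zero, Matrix.det_vandermonde_ne_zero_iff]
    intro a b hab
    exact Fin.ext (Nat.cast_injective hab)
  refine ⟨(W⁻¹ : Matrix (Fin (k + 1)) (Fin (k + 1)) ℂ), fun w v => ?_⟩
  have := congrFun (congrFun (Matrix.nonsing_inv_mul W hdet) w) v
  rw [Matrix.mul_apply, Matrix.one_apply] at this
  exact this

theorem sum_val_lt {k : ℕ} (β : Fin k → Fin 2) : ∑ r, (β r : ℕ) < k + 1 := by
  have : ∑ r, (β r : ℕ) ≤ ∑ _r : Fin k, 1 := Finset.sum_le_sum fun r _ => by omega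
  simp only [Finset.sum_const, Finset.card_univ, Fintype.card_fin, smul_eq_mul, mul_one] at this
  omega

theorem sum_vandermonde_dual_mul {k : ℕ} {c : Fin (k + 1) → Fin (k + 1) → ℂ}
    (hc : ∀ w v : Fin (k + 1), ∑ t, c w t * ((t : ℕ) : ℂ) ^ (v : ℕ) = if w = v then 1 else 0)
    (w : Fin (k + 1)) (u : (Fin k → Fin 2) → ℂ) :
    ∑ t, c w t * ∑ β : Fin k → Fin 2, ((t : ℕ) : ℂ) ^ (∑ r, (β r : ℕ)) * u β =
      ∑ β : Fin k → Fin 2, if (w : ℕ) = ∑ r, (β r : ℕ) then u β else 0 := by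
  simp_rw [Finset.mul_sum]
  rw [Finset.sum_comm]
  refine Finset.sum_congr rfl fun β _ => ?_
  have := hc w ⟨_, sum_val_lt β⟩
  simp only [Fin.ext_iff] at this
  simp_rw [← mul_assoc, ← Finset.sum_mul, this]
  split_ifs <;> simp

/-- Every symmetric form on a two-dimensional space is a linear combination of powers. -/
theorem exists_sum_powers (ρ : ℂ →+* ℂ) (k : ℕ) (e : Fin 2 → V) (x : Fin 2 → V → ℂ)
    (hx : ∀ s, ∑ b, x b s • e b = s) :
    ∃ (c : Fin (k + 1) → Fin (k + 1) → ℂ) (E : Fin (k + 1) → Fin k → V),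
      ∀ A : (Fin k → V) → ℂ, IsSemiMultilinear ρ A →
        (∀ (a : Fin k → V) (σ : Equiv.Perm (Fin k)), A (a ∘ σ) = A a) → ∀ a,
          A a = ∑ w, ∑ t, c w t * A (E w) *
            ∏ r, (ρ (x 0 (a r)) + ((t : ℕ) : ℂ) * ρ (x 1 (a r))) := by
  classical
  obtain ⟨c, hc⟩ := exists_vandermonde_dual k
  -- By symmetry `A (e ∘ β)` depends only on the number of ones in `β`, so one representative `E w`
  -- for each weight `w` suffices.
  have hE : ∀ w : Fin (k + 1), ∃ E : Fin k → V, ∀ β : Fin k → Fin 2, (w : ℕ) = ∑ r, (β r : ℕ) →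
      ∃ σ : Equiv.Perm (Fin k), E ∘ σ = e ∘ β := by
    intro w
    by_cases h : ∃ β : Fin k → Fin 2, (w : ℕ) = ∑ r, (β r : ℕ)
    · obtain ⟨β', hβ'⟩ := h
      refine ⟨e ∘ β', fun β hβ => ?_⟩
      obtain ⟨σ, hσ⟩ := exists_perm_comp_eq_of_sum_eq β β' (hβ.symm.trans hβ')
      exact ⟨σ, by rw [Function.comp_assoc, hσ]⟩
    · exact ⟨fun _ => 0, fun β hβ => (h ⟨β, hβ⟩).elim⟩
  choose E hE using hE
  refine ⟨c, E, fun A hA hs a => ?_⟩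
  -- A generating function in `t`: the coefficient of `t ^ v` collects the coordinate monomials of
  -- weight `v`. The dual Vandermonde coefficients will pick out a single weight.
  have hpow : ∀ t : Fin (k + 1), ∏ r, (ρ (x 0 (a r)) + ((t : ℕ) : ℂ) * ρ (x 1 (a r))) =
      ∑ β : Fin k → Fin 2, ((t : ℕ) : ℂ) ^ (∑ r, (β r : ℕ)) * ∏ r, ρ (x (β r) (a r)) := by
    intro t
    have : ∀ r, ρ (x 0 (a r)) + ((t : ℕ) : ℂ) * ρ (x 1 (a r)) =
        ∑ b : Fin 2, ((t : ℕ) : ℂ) ^ (b : ℕ) * ρ (x b (a r)) := by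
      intro r; simp [Fin.sum_univ_two]
    simp_rw [this, Fintype.prod_sum, Finset.prod_mul_distrib, Finset.prod_pow_eq_pow_sum]
  calc A a = A (fun r => ∑ b, x b (a r) • e b) := by simp_rw [hx]
    _ = ∑ β : Fin k → Fin 2, (∏ r, ρ (x (β r) (a r))) * A (e ∘ β) :=
        hA.map_sum_smul (fun b r => x b (a r)) e
    _ = ∑ β : Fin k → Fin 2, ∑ w : Fin (k + 1), A (E w) *
          (if (w : ℕ) = ∑ r, (β r : ℕ) then ∏ r, ρ (x (β r) (a r)) else 0) := by
        refine Finset.sum_congr rfl fun β _ => ?_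
        rw [Finset.sum_eq_single (⟨_, sum_val_lt β⟩ : Fin (k + 1))]
        · obtain ⟨σ, hσ⟩ := hE ⟨_, sum_val_lt β⟩ β rfl
          rw [if_pos rfl, ← hσ, hs]
          ring
        · intro w _ hw
          rw [if_neg, mul_zero]
          exact fun h => hw (Fin.ext h)
        · simp
    _ = ∑ w, A (E w) * ∑ t, c w t * ∏ r, (ρ (x 0 (a r)) + ((t : ℕ) : ℂ) * ρ (x 1 (a r))) := by
        rw [Finset.sum_comm]
        refine Finset.sum_congr rfl fun w _ => ?_
        rw [← Finset.mul_sum]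
        simp_rw [hpow]
        rw [sum_vandermonde_dual_mul hc]
    _ = _ := by
        refine Finset.sum_congr rfl fun w _ => ?_
        rw [Finset.mul_sum]
        exact Finset.sum_congr rfl fun t _ => by ring

/-- A symmetric form on a two-dimensional space is determined by its values on the diagonal. -/
theorem eq_zero_of_diagonal {ρ : ℂ →+* ℂ} {k : ℕ} {e : Fin 2 → V} {x : Fin 2 → V → ℂ}
    (hx : ∀ s, ∑ b, x b s • e b = s) {A : (Fin k → V) → ℂ} (hA : IsSemiMultilinear ρ A)
    (hs : ∀ (a : Fin k → V) (σ : Equiv.Perm (Fin k)), A (a ∘ σ) = A a)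
    (h0 : ∀ s, A (fun _ => s) = 0) : A = 0 := by
  classical
  obtain ⟨c, hc⟩ := exists_vandermonde_dual k
  have hbasis : ∀ β : Fin k → Fin 2, A (e ∘ β) = 0 := by
    intro β
    -- The diagonal value at `e 0 + t • e 1` is a polynomial in `t` whose coefficients are the sums
    -- of `A (e ∘ γ)` over `γ` of fixed weight; each of these sums must vanish.
    have hd : ∀ t : Fin (k + 1), ∑ γ : Fin k → Fin 2,
        ((t : ℕ) : ℂ) ^ (∑ r, (γ r : ℕ)) * A (e ∘ γ) = 0 := by
      intro t
      rw [← h0 (∑ b : Fin 2, (((t : ℕ) : ℂ) ^ (b : ℕ)) • e b),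
        hA.map_sum_smul (fun b _ => ((t : ℕ) : ℂ) ^ (b : ℕ)) e]
      refine Finset.sum_congr rfl fun γ _ => ?_
      simp_rw [map_pow, map_natCast, Finset.prod_pow_eq_pow_sum]
    have hw := sum_vandermonde_dual_mul hc ⟨_, sum_val_lt β⟩ (fun γ => A (e ∘ γ))
    simp_rw [hd, mul_zero, Finset.sum_const_zero] at hw
    have hcongr : ∀ γ : Fin k → Fin 2, (if ∑ r, (β r : ℕ) = ∑ r, (γ r : ℕ) then A (e ∘ γ) else 0) =
        if ∑ r, (β r : ℕ) = ∑ r, (γ r : ℕ) then A (e ∘ β) else 0 := by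
      intro γ
      split_ifs with h
      · obtain ⟨σ, hσ⟩ := exists_perm_comp_eq_of_sum_eq β γ h
        rw [← hσ, ← Function.comp_assoc, hs]
      · rfl
    -- By symmetry the sum over the weight class of `β` is its cardinality times `A (e ∘ β)`, and
    -- the class contains `β`.
    simp_rw [hcongr, ← Finset.sum_filter, Finset.sum_const, nsmul_eq_mul] at hw
    rcases mul_eq_zero.1 hw.symm with h | h
    · exfalso
      rw [Nat.cast_eq_zero, Finset.card_eq_zero] at h
      have : β ∈ (∅ : Finset (Fin k → Fin 2)) := h ▸ Finset.mem_filter.2 ⟨Finset.mem_univ _, rfl⟩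
      simp at this
    · exact h
  funext a
  calc A a = A (fun r => ∑ b, x b (a r) • e b) := by simp_rw [hx]
    _ = 0 := by
      rw [hA.map_sum_smul (fun b r => x b (a r)) e]
      simp [hbasis]

end OneKind

/-! ### Contraction for one kind of index -/

section OneKind

variable {V : Type*} {ρ : ℂ →+* ℂ} {e : Fin 2 → V} {i k n p : ℕ}

theorem leftSlots_update_of_lt (hp : k - i ≤ p) (a : Fin p → V) (u : Fin i → V) (r : Fin p)
    (hr : (r : ℕ) < k - i) (s : V) :
    leftSlots k i hp (Function.update a r s) u =
      Function.update (leftSlots k i hp a u) ⟨r, by omega⟩ s := by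
  funext r'
  simp only [leftSlots, Function.update_apply, Fin.ext_iff]
  grind

theorem leftSlots_update_of_not_lt (hp : k - i ≤ p) (a : Fin p → V) (u : Fin i → V) (r : Fin p)
    (hr : ¬ (r : ℕ) < k - i) (s : V) :
    leftSlots k i hp (Function.update a r s) u = leftSlots k i hp a u := by
  funext r'
  simp only [leftSlots, Function.update_apply, Fin.ext_iff]
  grind

theorem rightSlots_update_of_not_lt (hp : n - i ≤ p) (a : Fin p → V) (u : Fin i → V) (r : Fin p)
    (hr : ¬ (r : ℕ) < p - (n - i)) (s : V) :
    rightSlots n i hp (Function.update a r s) u =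
      Function.update (rightSlots n i hp a u) ⟨r - (p - (n - i)), by omega⟩ s := by
  funext r'
  simp only [rightSlots, Function.update_apply, Fin.ext_iff]
  grind

theorem rightSlots_update_of_lt (hp : n - i ≤ p) (a : Fin p → V) (u : Fin i → V) (r : Fin p)
    (hr : (r : ℕ) < p - (n - i)) (s : V) :
    rightSlots n i hp (Function.update a r s) u = rightSlots n i hp a u := by
  funext r'
  simp only [rightSlots, Function.update_apply, Fin.ext_iff]
  grind

theorem leftSlots_const_zero (hp : k - 0 ≤ p) (s : V) (u : Fin 0 → V) :
    leftSlots k 0 hp (fun _ => s) u = fun _ => s := by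
  funext r
  simp [leftSlots]

theorem rightSlots_const_zero (hp : n - 0 ≤ p) (s : V) (u : Fin 0 → V) :
    rightSlots n 0 hp (fun _ => s) u = fun _ => s := by
  funext r
  simp [rightSlots]

theorem prod_leftSlots (hik : i ≤ k) (hp : k - i ≤ p) (a : Fin p → V) (u : Fin i → V)
    (f : V → ℂ) : ∏ r, f (leftSlots k i hp a u r) =
      (∏ r : Fin p, if (r : ℕ) < k - i then f (a r) else 1) * ∏ r, f (u r) := by
  obtain ⟨α, rfl⟩ := Nat.exists_eq_add_of_le' hik
  obtain ⟨β, rfl⟩ : ∃ β, p = α + β := ⟨p - α, by omega⟩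
  simp only [Fin.prod_univ_add, leftSlots]
  simp [Fin.castAdd, Fin.castLE]

theorem prod_rightSlots (hin : i ≤ n) (hp : n - i ≤ p) (a : Fin p → V) (u : Fin i → V)
    (f : V → ℂ) : ∏ r, f (rightSlots n i hp a u r) =
      (∏ r : Fin p, if (r : ℕ) < p - (n - i) then 1 else f (a r)) * ∏ r, f (u r) := by
  obtain ⟨β, rfl⟩ := Nat.exists_eq_add_of_le' hin
  obtain ⟨α, rfl⟩ : ∃ α, p = α + β := ⟨p - β, by omega⟩
  simp only [Fin.prod_univ_add, rightSlots]
  simp [Fin.natAdd]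

/-- Contraction of `i` index pairs followed by symmetrization, for one kind of index. -/
def contract1 (e : Fin 2 → V) {k n : ℕ} (i p : ℕ) (A : (Fin k → V) → ℂ) (C : (Fin n → V) → ℂ) :
    (Fin p → V) → ℂ :=
  if h : i ≤ k ∧ i ≤ n ∧ p + 2 * i = k + n then
    fun a => (p.factorial : ℂ)⁻¹ * ∑ σ : Equiv.Perm (Fin p), ∑ β : Fin i → Fin 2,
      (∏ r, (-1 : ℂ) ^ (β r : ℕ)) *
        (A (leftSlots k i (by omega) (a ∘ σ) (fun r => e (1 - β r))) *
          C (rightSlots n i (by omega) (a ∘ σ) (fun r => e (β r))))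
  else 0

theorem contract1_of_valence (h : i ≤ k ∧ i ≤ n ∧ p + 2 * i = k + n) (A : (Fin k → V) → ℂ)
    (C : (Fin n → V) → ℂ) (a : Fin p → V) :
    contract1 e i p A C a = (p.factorial : ℂ)⁻¹ * ∑ σ : Equiv.Perm (Fin p), ∑ β : Fin i → Fin 2,
      (∏ r, (-1 : ℂ) ^ (β r : ℕ)) *
        (A (leftSlots k i (by omega) (a ∘ σ) (fun r => e (1 - β r))) *
          C (rightSlots n i (by omega) (a ∘ σ) (fun r => e (β r)))) := by
  rw [contract1, dif_pos h]

/-- On the diagonal all permutations contribute equally, so the symmetrization drops out. -/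
theorem contract1_const (h : i ≤ k ∧ i ≤ n ∧ p + 2 * i = k + n) (A : (Fin k → V) → ℂ)
    (C : (Fin n → V) → ℂ) (s : V) :
    contract1 e i p A C (fun _ => s) = ∑ β : Fin i → Fin 2, (∏ r, (-1 : ℂ) ^ (β r : ℕ)) *
        (A (leftSlots k i (by omega) (fun _ : Fin p => s) (fun r => e (1 - β r))) *
          C (rightSlots n i (by omega) (fun _ : Fin p => s) (fun r => e (β r)))) := by
  rw [contract1_of_valence h]
  simp only [Function.comp_def, Finset.sum_const, Finset.card_univ, Fintype.card_perm,
    Fintype.card_fin, nsmul_eq_mul]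
  rw [inv_mul_cancel_left₀ (Nat.cast_ne_zero.2 p.factorial_ne_zero)]

theorem contract1_comp_perm (A : (Fin k → V) → ℂ) (C : (Fin n → V) → ℂ) (a : Fin p → V)
    (τ : Equiv.Perm (Fin p)) : contract1 e i p A C (a ∘ τ) = contract1 e i p A C a := by
  by_cases h : i ≤ k ∧ i ≤ n ∧ p + 2 * i = k + n
  · rw [contract1_of_valence h, contract1_of_valence h]
    congr 1
    exact Fintype.sum_equiv (Equiv.mulLeft τ) _ _ fun σ => rfl
  · simp [contract1, h]

/-- The power `f_{A₁} ⋯ f_{A_k}` of a form with one index. -/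
def power (f : V → ℂ) (k : ℕ) : (Fin k → V) → ℂ := fun a => ∏ r, f (a r)

variable [AddCommGroup V] [Module ℂ V]

/-- After any permutation a given free argument fills exactly one slot of exactly one of the two
factors. -/
theorem IsSemiMultilinear.contract1 {A : (Fin k → V) → ℂ} {C : (Fin n → V) → ℂ}
    (hA : IsSemiMultilinear ρ A) (hC : IsSemiMultilinear ρ C) :
    IsSemiMultilinear ρ (contract1 e i p A C) := by
  by_cases h : i ≤ k ∧ i ≤ n ∧ p + 2 * i = k + n
  swap
  · constructor <;> simp [SymSpin.contract1, h]
  have hup : ∀ (a : Fin p → V) (r : Fin p) (s : V) (σ : Equiv.Perm (Fin p)),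
      Function.update a r s ∘ σ = Function.update (a ∘ σ) (σ.symm r) s := fun a r s σ =>
    Function.update_comp_equiv a σ r s
  constructor
  · intro a r s t
    simp only [contract1_of_valence h, ← mul_add, ← Finset.sum_add_distrib, hup]
    congr 1
    refine Finset.sum_congr rfl fun σ _ => Finset.sum_congr rfl fun β _ => ?_
    congr 1
    by_cases hr : ((σ.symm r : Fin p) : ℕ) < k - i
    · simp only [leftSlots_update_of_lt _ _ _ _ hr, rightSlots_update_of_lt _ _ _ _
        (show ((σ.symm r : Fin p) : ℕ) < p - (n - i) by omega), hA.map_add, add_mul]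
    · simp only [leftSlots_update_of_not_lt _ _ _ _ hr, rightSlots_update_of_not_lt _ _ _ _
        (show ¬ ((σ.symm r : Fin p) : ℕ) < p - (n - i) by omega), hC.map_add, mul_add]
  · intro a r c s
    simp only [contract1_of_valence h, hup]
    rw [mul_left_comm]
    congr 1
    simp only [Finset.mul_sum]
    refine Finset.sum_congr rfl fun σ _ => Finset.sum_congr rfl fun β _ => ?_
    by_cases hr : ((σ.symm r : Fin p) : ℕ) < k - i
    · simp only [leftSlots_update_of_lt _ _ _ _ hr, rightSlots_update_of_lt _ _ _ _
        (show ((σ.symm r : Fin p) : ℕ) < p - (n - i) by omega), hA.map_smul]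
      ring
    · simp only [leftSlots_update_of_not_lt _ _ _ _ hr, rightSlots_update_of_not_lt _ _ _ _
        (show ¬ ((σ.symm r : Fin p) : ℕ) < p - (n - i) by omega), hC.map_smul]
      ring

/-- Semilinear forms along `ρ`. -/
structure IsSemilinear (ρ : ℂ →+* ℂ) (f : V → ℂ) : Prop where
  map_add : ∀ s t, f (s + t) = f s + f t
  map_smul : ∀ (c : ℂ) s, f (c • s) = ρ c * f s

end OneKind

/-! ### Contractions of powers of linear forms -/

section OneKind

variable {V : Type*} {ρ : ℂ →+* ℂ} {e : Fin 2 → V} {i k n p : ℕ}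

/-- The contraction `f^A g_A` of two forms with one index. -/
def bracket (e : Fin 2 → V) (f g : V → ℂ) : ℂ := f (e 1) * g (e 0) - f (e 0) * g (e 1)

/-- The symmetrization of `f_{A₁} ⋯ f_{A_α} g_{A_{α+1}} ⋯ g_{A_p}`. -/
def symPower (f g : V → ℂ) (α p : ℕ) : (Fin p → V) → ℂ := fun a =>
  (p.factorial : ℂ)⁻¹ * ∑ σ : Equiv.Perm (Fin p), ∏ r : Fin p,
    (if (r : ℕ) < α then f else g) (a (σ r))

theorem bracket_swap (e : Fin 2 → V) (f g : V → ℂ) : bracket e g f = -bracket e f g := by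
  simp only [bracket]; ring

theorem factorial_inv_mul_sum_perm_const (p : ℕ) (c : ℂ) :
    (p.factorial : ℂ)⁻¹ * ∑ _σ : Equiv.Perm (Fin p), c = c := by
  simp only [Finset.sum_const, Finset.card_univ, Fintype.card_perm, Fintype.card_fin,
    nsmul_eq_mul]
  rw [inv_mul_cancel_left₀ (Nat.cast_ne_zero.2 p.factorial_ne_zero)]

/-- The sum over `σ` does not depend on `x`, since a transposition moves `x` to any other point;
averaging over `x` then gives the mean of `h`. -/
theorem mul_inv_factorial_mul_sum_perm (h : Fin p → ℂ) (x : Fin p) :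
    (p : ℂ) * ((p.factorial : ℂ)⁻¹ * ∑ σ : Equiv.Perm (Fin p), h (σ x)) = ∑ r, h r := by
  have hx : ∀ y, ∑ σ : Equiv.Perm (Fin p), h (σ y) = ∑ σ : Equiv.Perm (Fin p), h (σ x) := by
    intro y
    refine Fintype.sum_equiv (Equiv.mulRight (Equiv.swap x y)) _ _ fun σ => ?_
    simp
  have h1 : (p : ℂ) * ∑ σ : Equiv.Perm (Fin p), h (σ x) =
      ∑ _σ : Equiv.Perm (Fin p), ∑ r, h r := by
    calc (p : ℂ) * ∑ σ : Equiv.Perm (Fin p), h (σ x)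
        = ∑ y : Fin p, ∑ σ : Equiv.Perm (Fin p), h (σ y) := by simp [hx]
      _ = ∑ σ : Equiv.Perm (Fin p), ∑ y : Fin p, h (σ y) := Finset.sum_comm
      _ = _ := Finset.sum_congr rfl fun σ _ => Equiv.sum_comp σ h
  rw [mul_left_comm, h1, factorial_inv_mul_sum_perm_const]

theorem symPower_const (f g : V → ℂ) {α β : ℕ} (s : V) :
    symPower f g α (α + β) (fun _ => s) = f s ^ α * g s ^ β := by
  simp only [symPower]
  rw [factorial_inv_mul_sum_perm_const, Fin.prod_univ_add]
  simp

theorem symPower_zero (f g : V → ℂ) (p : ℕ) : symPower f g 0 p = power g p := by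
  funext a
  simp only [symPower, power, Nat.not_lt_zero, if_false]
  simp_rw [Equiv.prod_comp _ fun r => g (a r)]
  exact factorial_inv_mul_sum_perm_const p _

/-- For powers the contracted pairs are independent of each other and of the free slots: the sum
over `β` is the expansion of `bracket e f g ^ i`. -/
theorem contract1_power (h : i ≤ k ∧ i ≤ n ∧ p + 2 * i = k + n) (f g : V → ℂ) :
    contract1 e i p (power f k) (power g n) = bracket e f g ^ i • symPower f g (k - i) p := by
  funext a
  rw [contract1_of_valence h]
  simp only [power, Pi.smul_apply, smul_eq_mul, symPower]
  rw [mul_left_comm]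
  congr 1
  rw [Finset.mul_sum]
  refine Finset.sum_congr rfl fun σ _ => ?_
  have hbr : bracket e f g ^ i = ∑ β : Fin i → Fin 2,
      ∏ r, ((-1 : ℂ) ^ (β r : ℕ) * (f (e (1 - β r)) * g (e (β r)))) := by
    have := Fintype.prod_sum fun (_ : Fin i) (b : Fin 2) =>
      (-1 : ℂ) ^ (b : ℕ) * (f (e (1 - b)) * g (e b))
    rw [← this]
    simp only [Finset.prod_const, Finset.card_univ, Fintype.card_fin, Fin.sum_univ_two]
    congr 1
    simp [bracket]
    ring
  rw [hbr, Finset.sum_mul]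
  refine Finset.sum_congr rfl fun β _ => ?_
  rw [prod_leftSlots h.1, prod_rightSlots h.2.1]
  have hsplit : ∏ r : Fin p, (if (r : ℕ) < k - i then f else g) (a (σ r)) =
      (∏ r : Fin p, if (r : ℕ) < k - i then f ((a ∘ σ) r) else 1) *
        ∏ r : Fin p, if (r : ℕ) < p - (n - i) then 1 else g ((a ∘ σ) r) := by
    rw [← Finset.prod_mul_distrib]
    refine Finset.prod_congr rfl fun r _ => ?_
    have : p - (n - i) = k - i := by omega
    rw [this]
    split_ifs <;> simp
  rw [hsplit, Finset.prod_mul_distrib, Finset.prod_mul_distrib]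
  ring

theorem contract1_power_one_const {m : ℕ} (f : V → ℂ) (A : (Fin m → V) → ℂ) (s : V) :
    contract1 e 0 (m + 1) (power f 1) A (fun _ => s) = f s * A (fun _ => s) := by
  rw [contract1_const (by omega)]
  simp [leftSlots_const_zero, rightSlots_const_zero, power]

theorem contract1_one_power {m : ℕ} (a f : V → ℂ) :
    contract1 e 1 m (power a 1) (power f (m + 1)) = bracket e a f • power f m := by
  rw [contract1_power (by omega), Nat.sub_self, symPower_zero, pow_one]

/-- Contraction of a vector with a symmetrized product, on the diagonal. -/
theorem contract1_one_symPower_const {α β m : ℕ} (hm : m + 1 = α + β) (a f g : V → ℂ) (s : V) :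
    ((m : ℂ) + 1) * contract1 e 1 m (power a 1) (symPower f g α (m + 1)) (fun _ => s) =
      α * bracket e a f * f s ^ (α - 1) * g s ^ β +
        β * bracket e a g * f s ^ α * g s ^ (β - 1) := by
  have hc1 : (Finset.univ.filter fun r : Fin (m + 1) => (r : ℕ) < α).card = α := by
    rw [Fin.card_filter_val_lt]; omega
  have hc2 : (Finset.univ.filter fun r : Fin (m + 1) => ¬ (r : ℕ) < α).card = β := by
    have := Finset.card_filter_add_card_filter_not (s := (Finset.univ : Finset (Fin (m + 1))))
      (fun r => (r : ℕ) < α)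
    simp only [Finset.card_univ, Fintype.card_fin] at this
    omega
  have hlast : ∀ t : V, ((m : ℂ) + 1) * symPower f g α (m + 1)
      (Function.update (fun _ => s) (Fin.last m) t) =
      α * f t * f s ^ (α - 1) * g s ^ β + β * g t * f s ^ α * g s ^ (β - 1) := by
    intro t
    -- Only the position that `σ` sends to the last slot sees `t`; it carries `f` or `g` according
    -- to whether it lies below `α`.
    have hp : ∀ σ : Equiv.Perm (Fin (m + 1)), ∏ r : Fin (m + 1), (if (r : ℕ) < α then f else g)
        (Function.update (fun _ => s) (Fin.last m) t (σ r)) =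
        if ((σ⁻¹ (Fin.last m) : Fin (m + 1)) : ℕ) < α then f t * f s ^ (α - 1) * g s ^ β
          else g t * f s ^ α * g s ^ (β - 1) := by
      intro σ
      have hupd : ∀ r, Function.update (fun _ => s) (Fin.last m) t (σ r) =
          Function.update (fun _ => s) (σ⁻¹ (Fin.last m)) t r := by
        intro r
        simp only [Function.update_apply, Equiv.Perm.eq_inv_iff_eq]
      simp_rw [hupd]
      generalize σ⁻¹ (Fin.last m) = x
      have hcard : ∀ h : Fin (m + 1) → V → ℂ, ∏ r, h r (Function.update (fun _ => s) x t r) =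
          h x t * ∏ r ∈ Finset.univ.erase x, h r s := by
        intro h
        rw [← Finset.mul_prod_erase _ _ (Finset.mem_univ x), Function.update_self]
        congr 1
        refine Finset.prod_congr rfl fun r hr => ?_
        rw [Function.update_of_ne (Finset.ne_of_mem_erase hr)]
      rw [hcard fun r => if (r : ℕ) < α then f else g]
      have happ : ∀ r : Fin (m + 1), (if (r : ℕ) < α then f else g) s =
        if (r : ℕ) < α then f s else g s := fun r => by split_ifs <;> rfl
      simp_rw [happ, Finset.prod_ite, Finset.prod_const]
      rw [Finset.filter_erase, Finset.filter_erase]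
      by_cases hx : (x : ℕ) < α
      · rw [Finset.card_erase_of_mem (by simp [hx]), Finset.erase_eq_of_notMem (by simp [hx]),
          hc1, hc2]
        simp [hx, mul_assoc]
      · rw [Finset.erase_eq_of_notMem (by simp [hx]), Finset.card_erase_of_mem (by simpa using hx),
          hc1, hc2]
        simp [hx, mul_assoc]
    simp only [symPower]
    simp_rw [hp]
    let h : Fin (m + 1) → ℂ := fun r =>
      if (r : ℕ) < α then f t * f s ^ (α - 1) * g s ^ β else g t * f s ^ α * g s ^ (β - 1)
    -- The relevant position is a preimage under `σ`, so the sum is reindexed by inversion before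
    -- averaging.
    have hinv : ∑ σ : Equiv.Perm (Fin (m + 1)), h (σ⁻¹ (Fin.last m)) =
        ∑ σ : Equiv.Perm (Fin (m + 1)), h (σ (Fin.last m)) :=
      Equiv.sum_comp (Equiv.inv (Equiv.Perm (Fin (m + 1)))) fun σ => h (σ (Fin.last m))
    have hsum := mul_inv_factorial_mul_sum_perm h (Fin.last m)
    rw [Nat.cast_add, Nat.cast_one, ← hinv] at hsum
    refine hsum.trans ?_
    simp only [h, Finset.sum_ite, Finset.sum_const, hc1, hc2, nsmul_eq_mul]
    ring
  rw [contract1_const (by omega)]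
  have hr : ∀ u : Fin 1 → V, rightSlots (m + 1) 1 (by omega) (fun _ : Fin m => s) u =
      Function.update (fun _ => s) (Fin.last m) (u 0) := by
    intro u
    funext r
    simp only [rightSlots, Function.update_apply, Fin.ext_iff, Fin.val_last]
    by_cases h : (r : ℕ) < m
    · simp [h, h.ne]
    · have : (r : ℕ) = m := by omega
      simp [this]
  have hl : ∀ u : Fin 1 → V, power a 1 (leftSlots 1 1 (by omega) (fun _ : Fin m => s) u) =
      a (u 0) := by
    intro u
    simp [power, leftSlots]
  simp only [hr, hl]
  rw [Fintype.sum_equiv (Equiv.funUnique (Fin 1) (Fin 2)) _ (fun b => (-1 : ℂ) ^ (b : ℕ) *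
    (a (e (1 - b)) * symPower f g α (m + 1) (Function.update (fun _ => s) (Fin.last m) (e b))))
    (fun β => by simp)]
  simp only [Fin.sum_univ_two, bracket]
  simp only [Fin.isValue, Fin.val_zero, pow_zero, sub_zero, one_mul, Fin.val_one, pow_one, sub_self]
  linear_combination a (e 1) * hlast (e 0) - a (e 0) * hlast (e 1)

end OneKind

/-! ### The one-kind Leibniz identities for powers -/

section OneKind

variable {V : Type*} {ρ : ℂ →+* ℂ} {e : Fin 2 → V} {i k n p : ℕ}

/-- The permutations place `a` in every slot equally often, so the symmetrization is an average over
the slot of `a`. -/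
theorem symPower_one (a f : V → ℂ) (n : ℕ) (d : Fin (n + 1) → V) :
    ((n : ℂ) + 1) * symPower a f 1 (n + 1) d =
      ∑ r, a (d r) * ∏ j ∈ Finset.univ.erase r, f (d j) := by
  have hp : ∀ σ : Equiv.Perm (Fin (n + 1)), ∏ r : Fin (n + 1),
      (if (r : ℕ) < 1 then a else f) (d (σ r)) =
        a (d (σ 0)) * ∏ j ∈ Finset.univ.erase (σ 0), f (d j) := by
    intro σ
    rw [← Finset.mul_prod_erase _ _ (Finset.mem_univ 0)]
    congr 1
    refine Finset.prod_equiv σ (by simp) fun r hr => ?_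
    have h0 : ¬ (r : ℕ) < 1 := by
      have := Finset.ne_of_mem_erase hr
      rw [ne_eq, Fin.ext_iff, Fin.val_zero] at this
      omega
    rw [if_neg h0]
  have := mul_inv_factorial_mul_sum_perm
    (fun r => a (d r) * ∏ j ∈ Finset.univ.erase r, f (d j)) (0 : Fin (n + 1))
  rw [Nat.cast_add, Nat.cast_one] at this
  rw [← this]
  simp only [symPower, hp]

/-- The symmetrized product of `a` with a power of `f` is a derivative of pure powers, so its
contractions are obtained by differentiating `contract1_power`. -/
theorem hasDerivAt_power (a f : V → ℂ) (n : ℕ) (d : Fin (n + 1) → V) :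
    HasDerivAt (fun z : ℂ => power (f + z • a) (n + 1) d)
      (((n : ℂ) + 1) * symPower a f 1 (n + 1) d) 0 := by
  have h1 : ∀ r ∈ (Finset.univ : Finset (Fin (n + 1))),
      HasDerivAt (fun z : ℂ => (f + z • a) (d r)) (a (d r)) 0 := by
    intro r _
    simpa using ((hasDerivAt_id (0 : ℂ)).mul_const (a (d r))).const_add (f (d r))
  have := HasDerivAt.fun_finsetProd h1
  rw [symPower_one]
  refine this.congr_deriv ?_
  refine Finset.sum_congr rfl fun r _ => ?_
  simp [mul_comm]

/-- Contraction of a power with a symmetrized product `a f⋯f`, on the diagonal. -/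
theorem contract1_power_symPower_const {m : ℕ} (h : m ≤ k ∧ m ≤ n + 1 ∧ p + 2 * m = k + (n + 1))
    (a f g : V → ℂ) (s : V) :
    ((n : ℂ) + 1) * contract1 e m p (power g k) (symPower a f 1 (n + 1)) (fun _ => s) =
      g s ^ (k - m) * (m * bracket e g f ^ (m - 1) * bracket e g a * f s ^ (n + 1 - m) +
        bracket e g f ^ m * (((n : ℂ) + 1 - m) * f s ^ (n - m) * a s)) := by
  -- The contraction of `g^k` with `(f + z a)^(n+1)` is differentiated at `z = 0` in two ways: term
  -- by term here, and from its closed form in `hR`.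
  have hL : HasDerivAt
      (fun z : ℂ => contract1 e m p (power g k) (power (f + z • a) (n + 1)) (fun _ => s))
      (((n : ℂ) + 1) * contract1 e m p (power g k) (symPower a f 1 (n + 1)) (fun _ => s)) 0 := by
    simp only [contract1_const h, Finset.mul_sum]
    refine HasDerivAt.fun_sum fun β _ => ?_
    have := ((hasDerivAt_power a f n (rightSlots (n + 1) m (by omega) (fun _ : Fin p => s)
      (fun r => e (β r)))).const_mul
      (power g k (leftSlots k m (by omega) (fun _ : Fin p => s) (fun r => e (1 - β r))))).const_mul
      (∏ r, (-1 : ℂ) ^ (β r : ℕ))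
    exact this.congr_deriv (by ring)
  have hR : HasDerivAt
      (fun z : ℂ => contract1 e m p (power g k) (power (f + z • a) (n + 1)) (fun _ => s))
      (g s ^ (k - m) * (m * bracket e g f ^ (m - 1) * bracket e g a * f s ^ (n + 1 - m) +
        bracket e g f ^ m * (((n : ℂ) + 1 - m) * f s ^ (n - m) * a s))) 0 := by
    have hfun : ∀ z : ℂ, contract1 e m p (power g k) (power (f + z • a) (n + 1)) (fun _ => s) =
        (bracket e g f + z * bracket e g a) ^ m *
          (g s ^ (k - m) * (f s + z * a s) ^ (n + 1 - m)) := by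
      intro z
      rw [contract1_power h]
      obtain ⟨β, rfl⟩ : ∃ β, p = (k - m) + β := ⟨p - (k - m), by omega⟩
      have hβ : n + 1 - m = β := by omega
      rw [Pi.smul_apply, symPower_const, hβ, smul_eq_mul]
      congr 2
      simp only [bracket, Pi.add_apply, Pi.smul_apply, smul_eq_mul]
      ring
    simp_rw [hfun]
    have hlin : ∀ b c : ℂ, HasDerivAt (fun z : ℂ => b + z * c) c 0 := fun b c => by
      simpa using ((hasDerivAt_id (0 : ℂ)).mul_const c).const_add b
    have := ((hlin (bracket e g f) (bracket e g a)).fun_pow m).fun_mul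
      (((hlin (f s) (a s)).fun_pow (n + 1 - m)).const_mul (g s ^ (k - m)))
    refine this.congr_deriv ?_
    -- For `m = n + 1` the truncated exponent is harmless, since its coefficient `n + 1 - m`
    -- vanishes.
    have hexp : n + 1 - m - 1 = n - m := by omega
    rw [Nat.cast_sub h.2.1, hexp]
    push_cast
    ring
  exact hL.unique hR

theorem contract1_smul_right (c : ℂ) (A : (Fin k → V) → ℂ) (C : (Fin n → V) → ℂ) :
    contract1 e i p A (c • C) = c • contract1 e i p A C := by
  by_cases h : i ≤ k ∧ i ≤ n ∧ p + 2 * i = k + n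
  · funext a
    simp only [contract1_of_valence h, Pi.smul_apply, smul_eq_mul, Finset.mul_sum]
    exact Finset.sum_congr rfl fun σ _ => Finset.sum_congr rfl fun β _ => by ring
  · simp [contract1, h]

variable [AddCommGroup V] [Module ℂ V]

theorem IsSemilinear.isSemiMultilinear_power {f : V → ℂ} (hf : IsSemilinear ρ f) (k : ℕ) :
    IsSemiMultilinear ρ (power f k) := by
  have hprod : ∀ (a : Fin k → V) (r : Fin k) (s : V), power f k (Function.update a r s) =
      f s * ∏ j ∈ Finset.univ.erase r, f (a j) := by
    intro a r s
    rw [power, ← Finset.mul_prod_erase _ _ (Finset.mem_univ r), Function.update_self]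
    congr 1
    refine Finset.prod_congr rfl fun j hj => ?_
    rw [Function.update_of_ne (Finset.ne_of_mem_erase hj)]
  constructor
  · intro a r s t
    simp only [hprod, hf.map_add, add_mul]
  · intro a r c s
    simp only [hprod, hf.map_smul, mul_assoc]

/-- The two-dimensional identity `ε_{A[B} ε_{CD]} = 0`. -/
theorem bracket_cyclic {x : Fin 2 → V → ℂ} (hx : ∀ s, ∑ b, x b s • e b = s) {a f g : V → ℂ}
    (ha : IsSemilinear ρ a) (hf : IsSemilinear ρ f) (hg : IsSemilinear ρ g) (s : V) :
    a s * bracket e f g + f s * bracket e g a + g s * bracket e a f = 0 := by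
  have hexp : ∀ {h : V → ℂ}, IsSemilinear ρ h →
      h s = ρ (x 0 s) * h (e 0) + ρ (x 1 s) * h (e 1) := by
    intro h hh
    conv_lhs => rw [← hx s, Fin.sum_univ_two]
    rw [hh.map_add, hh.map_smul, hh.map_smul]
  rw [hexp ha, hexp hf, hexp hg]
  simp only [bracket]
  ring

/-- Symmetrization of a vector with a contracted product of powers. -/
theorem contract1_zero_contract1 {x : Fin 2 → V → ℂ} (hx : ∀ s, ∑ b, x b s • e b = s)
    {a f g : V → ℂ} (ha : IsSemilinear ρ a) (hf : IsSemilinear ρ f) (hg : IsSemilinear ρ g)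
    {m : ℕ} (hmi : m ≤ i) (hmk : m ≤ k) (hp : p + 2 * m = i + k) :
    contract1 e 0 (p + 1) (power a 1) (contract1 e m p (power f i) (power g k)) =
      (-1 : ℂ) ^ m • contract1 e m (p + 1) (power g k)
          (contract1 e 0 (i + 1) (power a 1) (power f i)) +
        ((-1 : ℂ) ^ m * m / (i + 1)) • contract1 e (m - 1) (p + 1) (power g k)
          (contract1 e 1 (i - 1) (power a 1) (power f i)) := by
  have pa := ha.isSemiMultilinear_power 1
  have pf := hf.isSemiMultilinear_power i
  have pg := hg.isSemiMultilinear_power k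
  rw [← sub_eq_zero, sub_eq_add_neg, ← neg_one_smul ℂ]
  -- All terms are symmetric and semilinear in each slot, so the difference need only vanish on the
  -- diagonal.
  refine eq_zero_of_diagonal hx (ρ := ρ) ((pa.contract1 (pf.contract1 pg)).add
    ((((pg.contract1 (pa.contract1 pf)).smul _).add ((pg.contract1 (pa.contract1 pf)).smul _)).smul
      _)) ?_ ?_
  · intro c σ
    simp only [Pi.add_apply, Pi.smul_apply, contract1_comp_perm]
  intro s
  -- `α` and `β` count the uncontracted copies of `f` and of `g`.
  obtain ⟨α, rfl⟩ := Nat.exists_eq_add_of_le' hmi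
  obtain ⟨β, rfl⟩ := Nat.exists_eq_add_of_le' hmk
  obtain rfl : p = α + β := by omega
  have hne : ((α + m : ℕ) : ℂ) + 1 ≠ 0 := Nat.cast_add_one_ne_zero _
  have h1 := contract1_power_symPower_const (e := e) (k := β + m) (n := α + m) (p := α + β + 1)
    (m := m) (by omega) a f g s
  have hplu := bracket_cyclic hx ha hf hg s
  simp only [Pi.add_apply, Pi.smul_apply, smul_eq_mul]
  rw [contract1_power_one_const, contract1_power (by omega), contract1_power (i := 0) (by omega),
    Pi.smul_apply, Nat.add_sub_cancel, symPower_const, pow_zero, one_smul, Nat.sub_zero,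
    smul_eq_mul]
  rw [bracket_swap e f g] at h1
  -- For `m = 0` the truncated indices `m - 1` and possibly `i - 1` occur only with coefficient `0`.
  rcases m with _ | m
  · simp only [Nat.add_zero, pow_zero, Nat.cast_zero, zero_mul, zero_add, Nat.sub_zero, one_mul,
      sub_zero, mul_zero, zero_div, add_zero] at h1 hne ⊢
    have := mul_left_cancel₀ hne (h1.trans (show _ = ((α : ℂ) + 1) * (g s ^ β * (f s ^ α * a s))
      by ring))
    rw [this]
    ring
  · rw [Nat.add_sub_cancel] at h1 ⊢
    have e1 : α + (m + 1) - 1 = α + m := by omega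
    rw [e1, show α + (m + 1) = α + m + 1 by omega, contract1_one_power, contract1_smul_right,
      contract1_power (by omega), show β + (m + 1) - m = β + 1 by omega,
      show α + β + 1 = β + 1 + α by omega]
    rw [show α + β + 1 = β + 1 + α by omega, show α + (m + 1) + 1 - (m + 1) = α + 1 by omega,
      show α + (m + 1) - (m + 1) = α by omega, show α + (m + 1) = α + m + 1 by omega] at h1
    rw [show α + (m + 1) = α + m + 1 by omega] at hne
    simp only [Pi.smul_apply, symPower_const, smul_eq_mul, bracket_swap e f g]
    rw [Nat.add_sub_cancel (n := m) (m := 1)] at h1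
    rw [eq_div_of_mul_eq hne ((mul_comm _ _).trans h1)]
    simp only [pow_succ (-1 : ℂ) m, pow_succ (-bracket e f g) m, neg_pow (bracket e f g) m]
    push_cast at hne ⊢
    field_simp
    rcases neg_one_pow_eq_or ℂ m with hu | hu <;> simp only [hu] <;>
    -- After division by the common factors only the cyclic identity for `a`, `f`, `g` is left.
    linear_combination ((m : ℂ) + 1) * f s ^ α * g s ^ β * bracket e f g ^ m * hplu

/-- Contraction of a vector with a contracted product of powers. -/
theorem contract1_one_contract1 {x : Fin 2 → V → ℂ} (hx : ∀ s, ∑ b, x b s • e b = s)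
    {a f g : V → ℂ} (ha : IsSemilinear ρ a) (hf : IsSemilinear ρ f) (hg : IsSemilinear ρ g)
    {m : ℕ} (hmi : m ≤ i) (hmk : m ≤ k) (hp : p + 1 + 2 * m = i + k) :
    contract1 e 1 p (power a 1) (contract1 e m (p + 1) (power f i) (power g k)) =
      ((-1 : ℂ) ^ (m + 1) * (k - m) / (i + k - 2 * m)) • contract1 e (m + 1) p (power g k)
          (contract1 e 0 (i + 1) (power a 1) (power f i)) +
        ((-1 : ℂ) ^ m * (i - m) * (i + k - m + 1) / ((i + 1) * (i + k - 2 * m))) •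
          contract1 e m p (power g k) (contract1 e 1 (i - 1) (power a 1) (power f i)) := by
  have pa := ha.isSemiMultilinear_power 1
  have pf := hf.isSemiMultilinear_power i
  have pg := hg.isSemiMultilinear_power k
  rw [← sub_eq_zero, sub_eq_add_neg, ← neg_one_smul ℂ]
  refine eq_zero_of_diagonal hx (ρ := ρ) ((pa.contract1 (pf.contract1 pg)).add
    ((((pg.contract1 (pa.contract1 pf)).smul _).add ((pg.contract1 (pa.contract1 pf)).smul _)).smul
      _)) ?_ ?_
  · intro c σ
    simp only [Pi.add_apply, Pi.smul_apply, contract1_comp_perm]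
  intro s
  obtain ⟨α, rfl⟩ := Nat.exists_eq_add_of_le' hmi
  obtain ⟨β, rfl⟩ := Nat.exists_eq_add_of_le' hmk
  have hp' : p + 1 = α + β := by omega
  have hne : ((α + m : ℕ) : ℂ) + 1 ≠ 0 := Nat.cast_add_one_ne_zero _
  -- The denominator `i + k - 2 m` equals the number `p + 1` of free indices before contracting with
  -- `a`, hence is nonzero.
  have hpne : (α : ℂ) + β ≠ 0 := by
    rw [← Nat.cast_add, ← hp']
    exact Nat.cast_ne_zero.2 p.succ_ne_zero
  have hplu := bracket_cyclic hx ha hf hg s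
  rw [bracket_swap e a g] at hplu
  have hpc : (p : ℂ) + 1 = α + β := by rw [← Nat.cast_add, ← hp']; push_cast; ring
  have h0 := contract1_one_symPower_const (e := e) hp' a f g s
  rw [hpc] at h0
  have hden : ((α + m : ℕ) : ℂ) + ((β + m : ℕ) : ℂ) - 2 * m = α + β := by push_cast; ring
  simp only [Pi.add_apply, Pi.smul_apply, smul_eq_mul]
  rw [contract1_power (by omega), contract1_power (i := 0) (by omega), contract1_smul_right,
    Pi.smul_apply, Nat.add_sub_cancel, pow_zero, one_smul, Nat.sub_zero, smul_eq_mul,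
    eq_div_of_mul_eq hpne ((mul_comm _ _).trans h0), hden]
  -- For `α = 0` the second term has coefficient `i - m = 0`, so its truncated index `i - 1` never
  -- has to be evaluated.
  rcases α with _ | α
  · obtain ⟨β, rfl⟩ : ∃ β', β = β' + 1 := ⟨β - 1, by omega⟩
    have h1 := contract1_power_symPower_const (e := e) (k := β + 1 + m) (n := 0 + m) (p := p)
      (m := m + 1) (by omega) a f g s
    rw [show β + 1 + m - (m + 1) = β by omega, show m + 1 - 1 = m by omega,
      show 0 + m + 1 - (m + 1) = 0 by omega, show 0 + m - (m + 1) = 0 by omega] at h1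
    rw [eq_div_of_mul_eq hne ((mul_comm _ _).trans h1)]
    simp only [bracket_swap e f g, bracket_swap e a g]
    simp only [pow_succ (-1 : ℂ) m, pow_succ (-bracket e f g) m, neg_pow (bracket e f g) m]
    push_cast at hne hpne ⊢
    field_simp
    rcases neg_one_pow_eq_or ℂ m with hu | hu <;> simp only [hu] <;> simp <;> ring
  · rw [show α + 1 + m - 1 = α + m by omega, show α + 1 + m = α + m + 1 by omega,
      contract1_one_power, contract1_smul_right, contract1_power (by omega),
      show β + m - m = β by omega, show p = β + α by omega]
    simp only [Pi.smul_apply, symPower_const, smul_eq_mul]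
    rw [show α + 1 + m = α + m + 1 by omega] at hne
    -- For `β = 0` the factor `g^k` has no index left for an extra contraction; the first term has
    -- coefficient `k - m = 0`.
    rcases β with _ | β
    · simp only [bracket_swap e f g, pow_succ (-1 : ℂ) m, neg_pow (bracket e f g) m]
      push_cast at hne hpne ⊢
      field_simp
      rcases neg_one_pow_eq_or ℂ m with hu | hu <;> simp only [hu] <;> simp <;> ring
    · have h1 := contract1_power_symPower_const (e := e) (k := β + 1 + m) (n := α + m + 1)
        (p := β + 1 + α) (m := m + 1) (by omega) a f g s
      rw [show β + 1 + m - (m + 1) = β by omega, show m + 1 - 1 = m by omega,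
        show α + m + 1 + 1 - (m + 1) = α + 1 by omega,
        show α + m + 1 - (m + 1) = α by omega] at h1
      rw [eq_div_of_mul_eq hne ((mul_comm _ _).trans h1)]
      simp only [bracket_swap e f g, bracket_swap e a g]
      simp only [pow_succ (-1 : ℂ) m, pow_succ (-bracket e f g) m, neg_pow (bracket e f g) m]
      push_cast at hne hpne ⊢
      field_simp
      rcases neg_one_pow_eq_or ℂ m with hu | hu <;> simp only [hu] <;>
      linear_combination -((α : ℂ) + 1) * (β + 1) * f s ^ α * g s ^ β * bracket e f g ^ m * hplu

end OneKind

/-! ### Spinors with unprimed and primed indices -/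

section TwoKinds

variable {V : Type*} {e : Fin 2 → V} {k l n m p q i j : ℕ}

theorem contractSym_of_valence
    (h : (i ≤ k ∧ i ≤ n ∧ p + 2 * i = k + n) ∧ (j ≤ l ∧ j ≤ m ∧ q + 2 * j = l + m))
    (T : (Fin k → V) → (Fin l → V) → (Fin n → V) → (Fin m → V) → ℂ)
    (a : Fin p → V) (b : Fin q → V) :
    contractSym e i j p q T a b = ((p.factorial : ℂ) * (q.factorial : ℂ))⁻¹ *
        ∑ σ : Equiv.Perm (Fin p), ∑ τ : Equiv.Perm (Fin q),
          ∑ β : Fin i → Fin 2, ∑ γ : Fin j → Fin 2,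
            (∏ r, (-1 : ℂ) ^ (β r : ℕ)) * (∏ r, (-1 : ℂ) ^ (γ r : ℕ)) *
              T (leftSlots k i (by omega) (a ∘ σ) (fun r => e (1 - β r)))
                (leftSlots l j (by omega) (b ∘ τ) (fun r => e (1 - γ r)))
                (rightSlots n i (by omega) (a ∘ σ) (fun r => e (β r)))
                (rightSlots m j (by omega) (b ∘ τ) (fun r => e (γ r))) := by
  rw [contractSym, dif_pos h]

/-- `contractSym` as a linear map. -/
def contractSymₗ (e : Fin 2 → V) {k l n m : ℕ} (i j p q : ℕ) :
    ((Fin k → V) → (Fin l → V) → (Fin n → V) → (Fin m → V) → ℂ) →ₗ[ℂ] RawSpinor V p q where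
  toFun := contractSym e i j p q
  map_add' T T' := by
    by_cases h : (i ≤ k ∧ i ≤ n ∧ p + 2 * i = k + n) ∧ (j ≤ l ∧ j ≤ m ∧ q + 2 * j = l + m)
    · funext a b
      simp only [Pi.add_apply, contractSym_of_valence h, mul_add, Finset.sum_add_distrib]
    · simp [contractSym, h]
  map_smul' c T := by
    by_cases h : (i ≤ k ∧ i ≤ n ∧ p + 2 * i = k + n) ∧ (j ≤ l ∧ j ≤ m ∧ q + 2 * j = l + m)
    · funext a b
      simp only [Pi.smul_apply, contractSym_of_valence h, RingHom.id_apply, smul_eq_mul,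
        mul_left_comm _ c, Finset.mul_sum]
    · simp [contractSym, h]

/-- The tensor product of spinors. -/
def tensor {V : Type*} {k l n m : ℕ} :
    RawSpinor V k l →ₗ[ℂ] RawSpinor V n m →ₗ[ℂ]
      ((Fin k → V) → (Fin l → V) → (Fin n → V) → (Fin m → V) → ℂ) :=
  LinearMap.mk₂ ℂ (fun φ ψ a b c d => φ a b * ψ c d)
    (fun φ φ' ψ => by funext a b c d; simp [add_mul])
    (fun x φ ψ => by funext a b c d; simp [mul_assoc])
    (fun φ ψ ψ' => by funext a b c d; simp [mul_add])
    (fun x φ ψ => by funext a b c d; simp [mul_left_comm])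

theorem tensor_apply (φ : RawSpinor V k l) (ψ : RawSpinor V n m) (a : Fin k → V) (b : Fin l → V)
    (c : Fin n → V) (d : Fin m → V) : tensor φ ψ a b c d = φ a b * ψ c d := rfl

/-- A spinor with separated unprimed and primed dependence. -/
def outer (A : (Fin k → V) → ℂ) (B : (Fin l → V) → ℂ) : RawSpinor V k l := fun a b => A a * B b

/-- The sums over permutations and dyad labels of the two kinds are independent and factor. If
either kind has an impossible valence, both sides are zero. -/
theorem contractSym_tensor_outer (A : (Fin k → V) → ℂ) (B : (Fin l → V) → ℂ)
    (C : (Fin n → V) → ℂ) (D : (Fin m → V) → ℂ) :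
    contractSym e i j p q (tensor (outer A B) (outer C D)) =
      outer (contract1 e i p A C) (contract1 e j q B D) := by
  funext a b
  by_cases h1 : i ≤ k ∧ i ≤ n ∧ p + 2 * i = k + n
  swap
  · simp [contractSym, contract1, h1, outer]
  by_cases h2 : j ≤ l ∧ j ≤ m ∧ q + 2 * j = l + m
  swap
  · simp [contractSym, contract1, h2, outer]
  rw [contractSym_of_valence ⟨h1, h2⟩]
  simp only [outer, contract1_of_valence h1, contract1_of_valence h2, tensor_apply]
  rw [mul_inv, mul_mul_mul_comm]
  congr 1
  rw [Finset.sum_mul_sum]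
  refine Finset.sum_congr rfl fun σ _ => Finset.sum_congr rfl fun τ _ => ?_
  rw [Finset.sum_mul_sum]
  refine Finset.sum_congr rfl fun β _ => Finset.sum_congr rfl fun γ _ => ?_
  ring

/-- This reduces every identity between contractions to power spinors, in each factor separately. -/
theorem bilinear_eq_of_mem_span {E F G : Type*} [AddCommGroup E] [Module ℂ E] [AddCommGroup F]
    [Module ℂ F] [AddCommGroup G] [Module ℂ G] {P : Set E} {Q : Set F} (B B' : E →ₗ[ℂ] F →ₗ[ℂ] G)
    (h : ∀ x ∈ P, ∀ y ∈ Q, B x y = B' x y) {x : E} (hx : x ∈ Submodule.span ℂ P) {y : F}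
    (hy : y ∈ Submodule.span ℂ Q) : B x y = B' x y := by
  have hP : ∀ x ∈ P, B x y = B' x y := fun x hxP =>
    LinearMap.eqOn_span (f := B x) (g := B' x) (fun y hyQ => h x hxP y hyQ) hy
  exact LinearMap.eqOn_span (f := B.flip y) (g := B'.flip y) (fun x hxP => hP x hxP) hx

variable [AddCommGroup V] [Module ℂ V]

/-- Products of a power of a linear form and a power of a conjugate linear form. -/
def powerSpinors (V : Type*) [AddCommGroup V] [Module ℂ V] (k l : ℕ) : Set (RawSpinor V k l) :=
  {φ | ∃ f f' : V → ℂ, IsSemilinear (RingHom.id ℂ) f ∧ IsSemilinear (starRingEnd ℂ) f' ∧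
    φ = outer (power f k) (power f' l)}

/-- Products of a power spinor with a spinor of valence `(1, 1)`. -/
def powerDerivs (V : Type*) [AddCommGroup V] [Module ℂ V] (k l : ℕ) :
    Set ((Fin 1 → V) → (Fin 1 → V) → (Fin k → V) → (Fin l → V) → ℂ) :=
  {F | ∃ a a' f f' : V → ℂ, IsSemilinear (RingHom.id ℂ) a ∧ IsSemilinear (starRingEnd ℂ) a' ∧
    IsSemilinear (RingHom.id ℂ) f ∧ IsSemilinear (starRingEnd ℂ) f' ∧
    F = tensor (outer (power a 1) (power a' 1)) (outer (power f k) (power f' l))}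

theorem isSymSpinor_outer {A : (Fin k → V) → ℂ} {B : (Fin l → V) → ℂ}
    (hA : IsSemiMultilinear (RingHom.id ℂ) A) (hB : IsSemiMultilinear (starRingEnd ℂ) B)
    (sA : ∀ (a : Fin k → V) (σ : Equiv.Perm (Fin k)), A (a ∘ σ) = A a)
    (sB : ∀ (b : Fin l → V) (σ : Equiv.Perm (Fin l)), B (b ∘ σ) = B b) :
    IsSymSpinor (outer A B) where
  map_add a b r s t := by simp only [outer, hA.map_add]; ring
  map_smul a b r c s := by simp only [outer, hA.map_smul, RingHom.id_apply]; ring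
  map_add' a b r s t := by simp only [outer, hB.map_add]; ring
  map_smul' a b r c s := by simp only [outer, hB.map_smul]; ring
  symm a b σ τ := by simp only [outer, sA, sB]

theorem IsSymSpinor.add {φ ψ : RawSpinor V k l} (h : IsSymSpinor φ) (h' : IsSymSpinor ψ) :
    IsSymSpinor (φ + ψ) where
  map_add a b r s t := by simp only [Pi.add_apply, h.map_add, h'.map_add]; ring
  map_smul a b r c s := by simp only [Pi.add_apply, h.map_smul, h'.map_smul]; ring
  map_add' a b r s t := by simp only [Pi.add_apply, h.map_add', h'.map_add']; ring
  map_smul' a b r c s := by simp only [Pi.add_apply, h.map_smul', h'.map_smul']; ring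
  symm a b σ τ := by simp only [Pi.add_apply, h.symm, h'.symm]

theorem IsSymSpinor.smul {φ : RawSpinor V k l} (x : ℂ) (h : IsSymSpinor φ) :
    IsSymSpinor (x • φ) where
  map_add a b r s t := by simp only [Pi.smul_apply, smul_eq_mul, h.map_add]; ring
  map_smul a b r c s := by simp only [Pi.smul_apply, smul_eq_mul, h.map_smul]; ring
  map_add' a b r s t := by simp only [Pi.smul_apply, smul_eq_mul, h.map_add']; ring
  map_smul' a b r c s := by simp only [Pi.smul_apply, smul_eq_mul, h.map_smul']; ring
  symm a b σ τ := by simp only [Pi.smul_apply, h.symm]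

section Basis

variable {x : Fin 2 → V →ₗ[ℂ] ℂ}

/-- Polarization is applied twice: in the unprimed slots with the primed ones fixed, then in the
primed slots of the resulting values. -/
theorem IsSymSpinor.mem_span (hx : ∀ s, ∑ b, x b s • e b = s) {φ : RawSpinor V k l}
    (hφ : IsSymSpinor φ) : φ ∈ Submodule.span ℂ (powerSpinors V k l) := by
  obtain ⟨c, E, h⟩ := exists_sum_powers (RingHom.id ℂ) k e (fun b => x b) hx
  obtain ⟨c', E', h'⟩ := exists_sum_powers (starRingEnd ℂ) l e (fun b => x b) hx
  have h1 : ∀ b : Fin l → V, IsSemiMultilinear (RingHom.id ℂ) fun a => φ a b := fun b =>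
    ⟨fun a r s t => hφ.map_add a b r s t, fun a r c s => hφ.map_smul a b r c s⟩
  have h2 : ∀ a : Fin k → V, IsSemiMultilinear (starRingEnd ℂ) (φ a) := fun a =>
    ⟨fun b r s t => hφ.map_add' a b r s t, fun b r c s => hφ.map_smul' a b r c s⟩
  have hsum : φ = ∑ w, ∑ t, ∑ w', ∑ t', (c w t * c' w' t' * φ (E w) (E' w')) •
      outer (power (fun s => x 0 s + ((t : ℕ) : ℂ) * x 1 s) k)
        (power (fun s => starRingEnd ℂ (x 0 s) + ((t' : ℕ) : ℂ) * starRingEnd ℂ (x 1 s)) l) := by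
    funext a b
    rw [h (fun a => φ a b) (h1 b) (fun a σ => hφ.symm a b σ (Equiv.refl _)) a]
    simp only [Finset.sum_apply]
    refine Finset.sum_congr rfl fun w _ => Finset.sum_congr rfl fun t _ => ?_
    rw [h' (φ (E w)) (h2 (E w)) (fun b σ => hφ.symm (E w) b (Equiv.refl _) σ) b]
    simp only [Finset.mul_sum, Finset.sum_mul]
    refine Finset.sum_congr rfl fun w' _ => Finset.sum_congr rfl fun t' _ => ?_
    simp only [Pi.smul_apply, smul_eq_mul, outer, power, RingHom.id_apply]
    ring
  rw [hsum]
  refine Submodule.sum_mem _ fun w _ => Submodule.sum_mem _ fun t _ => Submodule.sum_mem _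
    fun w' _ => Submodule.sum_mem _ fun t' _ => Submodule.smul_mem _ _ (Submodule.subset_span ?_)
  refine ⟨_, _, ⟨fun s s' => ?_, fun z s => ?_⟩, ⟨fun s s' => ?_, fun z s => ?_⟩, rfl⟩
  · simp only [_root_.map_add]; ring
  · simp only [_root_.map_smul, smul_eq_mul, RingHom.id_apply]; ring
  · simp only [_root_.map_add]; ring
  · simp only [_root_.map_smul, smul_eq_mul, _root_.map_mul]; ring

/-- Contractions of symmetric spinors are symmetric spinors. -/
theorem contractSym_tensor_mem_span (hx : ∀ s, ∑ b, x b s • e b = s) {φ : RawSpinor V k l}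
    {ψ : RawSpinor V n m} (hφ : φ ∈ Submodule.span ℂ (powerSpinors V k l))
    (hψ : ψ ∈ Submodule.span ℂ (powerSpinors V n m)) :
    contractSym e i j p q (tensor φ ψ) ∈ Submodule.span ℂ (powerSpinors V p q) := by
  let B := tensor (V := V) (k := k) (l := l) (n := n) (m := m) |>.compr₂ (contractSymₗ e i j p q)
  -- Membership in the span is vanishing in the quotient, so it becomes a bilinear identity that can
  -- be tested on power spinors.
  have hspan : ∀ φ ∈ powerSpinors V k l, ∀ ψ ∈ powerSpinors V n m,
      ((Submodule.span ℂ (powerSpinors V p q)).mkQ ∘ₗ B φ) ψ = 0 := by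
    rintro _ ⟨f, f', hf, hf', rfl⟩ _ ⟨g, g', hg, hg', rfl⟩
    simp only [LinearMap.comp_apply, Submodule.mkQ_apply, Submodule.Quotient.mk_eq_zero]
    refine IsSymSpinor.mem_span (e := e) hx ?_
    change IsSymSpinor (contractSym e i j p q _)
    rw [contractSym_tensor_outer]
    exact isSymSpinor_outer
      ((hf.isSemiMultilinear_power k).contract1 (hg.isSemiMultilinear_power n))
      ((hf'.isSemiMultilinear_power l).contract1 (hg'.isSemiMultilinear_power m))
      (contract1_comp_perm _ _) (contract1_comp_perm _ _)
  have := bilinear_eq_of_mem_span (B.compr₂ (Submodule.span ℂ (powerSpinors V p q)).mkQ) 0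
    hspan hφ hψ
  exact (Submodule.Quotient.mk_eq_zero _).1 this

/-- Change of the dyad in a contraction of symmetric spinors. -/
theorem contractSym_tensor_change_dyad (hx : ∀ s, ∑ b, x b s • e b = s) (e' : Fin 2 → V)
    {φ : RawSpinor V k l}
    {ψ : RawSpinor V n m} (hφ : φ ∈ Submodule.span ℂ (powerSpinors V k l))
    (hψ : ψ ∈ Submodule.span ℂ (powerSpinors V n m)) :
    contractSym e' i j p q (tensor φ ψ) =
      ((x 0 (e' 0) * x 1 (e' 1) - x 1 (e' 0) * x 0 (e' 1)) ^ i *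
        starRingEnd ℂ (x 0 (e' 0) * x 1 (e' 1) - x 1 (e' 0) * x 0 (e' 1)) ^ j) •
        contractSym e i j p q (tensor φ ψ) := by
  -- `D` is the determinant of `e'` relative to `e`. A bracket is alternating in the dyad, so each
  -- contracted pair contributes one factor `D`, conjugated for primed indices.
  set D := x 0 (e' 0) * x 1 (e' 1) - x 1 (e' 0) * x 0 (e' 1) with hD
  have h1 : ∀ {ρ : ℂ →+* ℂ} {f g : V → ℂ} {k n i p : ℕ}, IsSemilinear ρ f → IsSemilinear ρ g →
      contract1 e' i p (power f k) (power g n) =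
        ρ D ^ i • contract1 e i p (power f k) (power g n) := by
    intro ρ f g k n i p hf hg
    by_cases h : i ≤ k ∧ i ≤ n ∧ p + 2 * i = k + n
    swap
    · simp [contract1, h]
    rw [contract1_power h, contract1_power h, smul_smul, ← mul_pow]
    congr 2
    have hexp : ∀ {h : V → ℂ}, IsSemilinear ρ h → ∀ s,
        h s = ρ (x 0 s) * h (e 0) + ρ (x 1 s) * h (e 1) := by
      intro h hh s
      conv_lhs => rw [← hx s, Fin.sum_univ_two]
      rw [hh.map_add, hh.map_smul, hh.map_smul]
    simp only [bracket]
    rw [hexp hf (e' 0), hexp hf (e' 1), hexp hg (e' 0), hexp hg (e' 1), hD]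
    simp only [map_sub, map_mul]
    ring
  refine bilinear_eq_of_mem_span ((tensor (V := V)).compr₂ (contractSymₗ e' i j p q))
    ((D ^ i * starRingEnd ℂ D ^ j) • (tensor (V := V)).compr₂ (contractSymₗ e i j p q)) ?_ hφ hψ
  rintro _ ⟨f, f', hf, hf', rfl⟩ _ ⟨g, g', hg, hg', rfl⟩
  change contractSym e' i j p q _ = (D ^ i * starRingEnd ℂ D ^ j) • contractSym e i j p q _
  rw [contractSym_tensor_outer, contractSym_tensor_outer, h1 hf hg, h1 hf' hg']
  funext a b
  simp only [outer, Pi.smul_apply, smul_eq_mul, RingHom.id_apply]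
  ring

/-- The factors of a symmetric product may be exchanged. -/
theorem contractSym_tensor_swap (hx : ∀ s, ∑ b, x b s • e b = s) {φ : RawSpinor V k l}
    {ψ : RawSpinor V n m} (hφ : φ ∈ Submodule.span ℂ (powerSpinors V k l))
    (hψ : ψ ∈ Submodule.span ℂ (powerSpinors V n m)) :
    contractSym e i j p q (tensor φ ψ) =
      (-1 : ℂ) ^ (i + j) • contractSym e i j p q (tensor ψ φ) := by
  -- On the diagonal the exchange only reverses the `i` brackets, each of which is antisymmetric.
  have h1 : ∀ {ρ : ℂ →+* ℂ} {f g : V → ℂ} {k n i p : ℕ}, IsSemilinear ρ f → IsSemilinear ρ g →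
      contract1 e i p (power f k) (power g n) =
        (-1 : ℂ) ^ i • contract1 e i p (power g n) (power f k) := by
    intro ρ f g k n i p hf hg
    by_cases h : i ≤ k ∧ i ≤ n ∧ p + 2 * i = k + n
    swap
    · rw [contract1, contract1, dif_neg h, dif_neg (by omega), smul_zero]
    have pf := hf.isSemiMultilinear_power k
    have pg := hg.isSemiMultilinear_power n
    rw [← sub_eq_zero, sub_eq_add_neg, ← neg_one_smul ℂ]
    refine eq_zero_of_diagonal hx (ρ := ρ) ((pf.contract1 pg).add
      (((pg.contract1 pf).smul _).smul _)) ?_ fun s => ?_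
    · intro c σ
      simp only [Pi.add_apply, Pi.smul_apply, contract1_comp_perm]
    simp only [Pi.add_apply, Pi.smul_apply, smul_eq_mul]
    rw [contract1_power h, contract1_power (by omega), Pi.smul_apply, Pi.smul_apply]
    obtain ⟨α, rfl⟩ := Nat.exists_eq_add_of_le' h.1
    obtain ⟨β, rfl⟩ := Nat.exists_eq_add_of_le' h.2.1
    obtain rfl : p = α + β := by omega
    have h2 := symPower_const g f (α := β) (β := α) s
    rw [Nat.add_comm] at h2
    rw [Nat.add_sub_cancel, Nat.add_sub_cancel, symPower_const, h2, bracket_swap e f g,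
      neg_pow (bracket e f g)]
    rcases neg_one_pow_eq_or ℂ i with hu | hu <;> simp only [hu, smul_eq_mul] <;> ring
  refine bilinear_eq_of_mem_span ((tensor (V := V)).compr₂ (contractSymₗ e i j p q))
    (((-1 : ℂ) ^ (i + j)) • ((tensor (V := V)).compr₂ (contractSymₗ e i j p q)).flip) ?_ hφ hψ
  rintro _ ⟨f, f', hf, hf', rfl⟩ _ ⟨g, g', hg, hg', rfl⟩
  change contractSym e i j p q _ = (-1 : ℂ) ^ (i + j) • contractSym e i j p q _
  rw [contractSym_tensor_outer, contractSym_tensor_outer, h1 hf hg, h1 hf' hg']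
  funext a b
  simp only [outer, Pi.smul_apply, smul_eq_mul, pow_add]
  ring

end Basis

end TwoKinds

/-! ### Infinitesimal change of the dyad and of the arguments -/

section Derivation

variable {V : Type*} {k l n m p q i j : ℕ}

/-- The action of `δ : V → V` on spinors by the product rule. -/
def slotDeriv (δ : V → V) (φ : RawSpinor V k l) : RawSpinor V k l := fun a b =>
  ∑ r, φ (Function.update a r (δ (a r))) b + ∑ r, φ a (Function.update b r (δ (b r)))

theorem leftSlots_map {W : Type*} {p k i : ℕ} (hp : k - i ≤ p) (a : Fin p → V) (u : Fin i → V)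
    (δ : V → W) (r : Fin k) :
    leftSlots k i hp (δ ∘ a) (δ ∘ u) r = δ (leftSlots k i hp a u r) := by
  simp only [leftSlots]
  split_ifs <;> rfl

theorem rightSlots_map {W : Type*} {p n i : ℕ} (hp : n - i ≤ p) (a : Fin p → V) (u : Fin i → V)
    (δ : V → W) (r : Fin n) :
    rightSlots n i hp (δ ∘ a) (δ ∘ u) r = δ (rightSlots n i hp a u r) := by
  simp only [rightSlots]
  split_ifs <;> rfl

variable [AddCommGroup V] [Module ℂ V]

/-- The parameter is real because forms in primed indices are conjugate linear, hence only real
differentiable in general. -/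
theorem hasDerivAt_power_line {ρ : ℂ →+* ℂ} (hρ : ∀ z : ℝ, ρ (z : ℂ) = z) {f : V → ℂ}
    (hf : IsSemilinear ρ f) (a a' : Fin k → V) :
    HasDerivAt (fun z : ℝ => power f k (a + (z : ℂ) • a'))
      (∑ r, power f k (Function.update a r (a' r))) 0 := by
  have h1 : ∀ r ∈ (Finset.univ : Finset (Fin k)),
      HasDerivAt (fun z : ℝ => f ((a + (z : ℂ) • a') r)) (f (a' r)) 0 := by
    intro r _
    simp only [Pi.add_apply, Pi.smul_apply, hf.map_add, hf.map_smul, hρ]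
    simpa using ((Complex.ofRealCLM.hasDerivAt (x := (0 : ℝ))).mul_const (f (a' r))).const_add
      (f (a r))
  have := HasDerivAt.fun_finsetProd h1
  refine this.congr_deriv ?_
  refine Finset.sum_congr rfl fun r _ => ?_
  rw [power, ← Finset.mul_prod_erase _ _ (Finset.mem_univ r), Function.update_self, smul_eq_mul,
    mul_comm]
  congr 1
  refine Finset.prod_congr rfl fun j hj => ?_
  rw [Function.update_of_ne (Finset.ne_of_mem_erase hj)]
  simp

theorem hasDerivAt_line {φ : RawSpinor V k l} (hφ : φ ∈ Submodule.span ℂ (powerSpinors V k l))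
    (a a' : Fin k → V) (b b' : Fin l → V) :
    HasDerivAt (fun z : ℝ => φ (a + (z : ℂ) • a') (b + (z : ℂ) • b'))
      (∑ r, φ (Function.update a r (a' r)) b + ∑ r, φ a (Function.update b r (b' r))) 0 := by
  induction hφ using Submodule.span_induction with
  | mem φ h =>
    obtain ⟨f, f', hf, hf', rfl⟩ := h
    have := (hasDerivAt_power_line (fun z => rfl) hf a a').fun_mul
      (hasDerivAt_power_line (fun z => Complex.conj_ofReal z) hf' b b')
    refine this.congr_deriv ?_
    simp [outer, Finset.mul_sum, Finset.sum_mul]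
  | zero => simpa using hasDerivAt_const (0 : ℝ) (0 : ℂ)
  | add φ ψ _ _ h h' =>
    refine (h.fun_add h').congr_deriv ?_
    simp only [Pi.add_apply, Finset.sum_add_distrib]
    ring
  | smul c φ _ h =>
    refine (h.const_mul c).congr_deriv ?_
    simp only [Pi.smul_apply, smul_eq_mul, Finset.mul_sum, mul_add]

theorem leftSlots_line {p k i : ℕ} (hp : k - i ≤ p) (a a' : Fin p → V) (u u' : Fin i → V) (z : ℂ) :
    leftSlots k i hp (a + z • a') (u + z • u') =
      leftSlots k i hp a u + z • leftSlots k i hp a' u' := by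
  funext r
  simp only [leftSlots, Pi.add_apply, Pi.smul_apply]
  split_ifs <;> rfl

theorem rightSlots_line {p n i : ℕ} (hp : n - i ≤ p) (a a' : Fin p → V) (u u' : Fin i → V)
    (z : ℂ) : rightSlots n i hp (a + z • a') (u + z • u') =
      rightSlots n i hp a u + z • rightSlots n i hp a' u' := by
  funext r
  simp only [rightSlots, Pi.add_apply, Pi.smul_apply]
  split_ifs <;> rfl

variable {e : Fin 2 → V} {x : Fin 2 → V →ₗ[ℂ] ℂ}

/-- Contraction with the bivector `e₀ ∧ e₁` commutes with a derivation up to its trace. -/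
theorem contractSym_slotDeriv (hx : ∀ s, ∑ b, x b s • e b = s)
    (hxe : ∀ b c, x b (e c) = if b = c then 1 else 0) (δ : V → V)
    {φ : RawSpinor V k l} {ψ : RawSpinor V n m}
    (hφ : φ ∈ Submodule.span ℂ (powerSpinors V k l))
    (hψ : ψ ∈ Submodule.span ℂ (powerSpinors V n m)) :
    contractSym e i j p q (tensor (slotDeriv δ φ) ψ + tensor φ (slotDeriv δ ψ)) =
      (i * (x 0 (δ (e 0)) + x 1 (δ (e 1))) +
          j * starRingEnd ℂ (x 0 (δ (e 0)) + x 1 (δ (e 1)))) • contractSym e i j p q (tensor φ ψ) +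
        slotDeriv δ (contractSym e i j p q (tensor φ ψ)) := by
  funext a b
  -- The dyad and the free arguments are moved simultaneously by `δ`. Every slot of both factors
  -- then moves by `δ`, so this derivative is the sum of the slotwise actions on `φ` and `ψ`.
  have hL : HasDerivAt (fun z : ℝ => contractSym (e + (z : ℂ) • (δ ∘ e)) i j p q (tensor φ ψ)
      (a + (z : ℂ) • (δ ∘ a)) (b + (z : ℂ) • (δ ∘ b)))
      (contractSym e i j p q (tensor (slotDeriv δ φ) ψ + tensor φ (slotDeriv δ ψ)) a b) 0 := by
    by_cases h : (i ≤ k ∧ i ≤ n ∧ p + 2 * i = k + n) ∧ (j ≤ l ∧ j ≤ m ∧ q + 2 * j = l + m)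
    swap
    · simpa [contractSym, h] using hasDerivAt_const (0 : ℝ) (0 : ℂ)
    simp only [contractSym_of_valence h]
    refine HasDerivAt.const_mul _ (HasDerivAt.fun_sum fun σ _ => HasDerivAt.fun_sum fun τ _ =>
      HasDerivAt.fun_sum fun β _ => HasDerivAt.fun_sum fun γ _ => HasDerivAt.const_mul _ ?_)
    simp only [tensor_apply, Pi.add_apply]
    have hl : ∀ {p k i : ℕ} (hp : k - i ≤ p) (a : Fin p → V) (σ : Equiv.Perm (Fin p))
        (u : Fin i → Fin 2) (z : ℝ), leftSlots k i hp ((a + (z : ℂ) • (δ ∘ a)) ∘ σ)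
          (fun r => (e + (z : ℂ) • (δ ∘ e)) (u r)) =
        leftSlots k i hp (a ∘ σ) (fun r => e (u r)) +
          (z : ℂ) • fun r => δ (leftSlots k i hp (a ∘ σ) (fun r => e (u r)) r) := by
      intro p k i hp a σ u z
      have := leftSlots_line hp (a ∘ σ) (δ ∘ a ∘ σ) (fun r => e (u r)) (δ ∘ fun r => e (u r)) z
      rw [funext (leftSlots_map hp (a ∘ σ) (fun r => e (u r)) δ)] at this
      exact this
    have hr : ∀ {p k i : ℕ} (hp : k - i ≤ p) (a : Fin p → V) (σ : Equiv.Perm (Fin p))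
        (u : Fin i → Fin 2) (z : ℝ), rightSlots k i hp ((a + (z : ℂ) • (δ ∘ a)) ∘ σ)
          (fun r => (e + (z : ℂ) • (δ ∘ e)) (u r)) =
        rightSlots k i hp (a ∘ σ) (fun r => e (u r)) +
          (z : ℂ) • fun r => δ (rightSlots k i hp (a ∘ σ) (fun r => e (u r)) r) := by
      intro p k i hp a σ u z
      have := rightSlots_line hp (a ∘ σ) (δ ∘ a ∘ σ) (fun r => e (u r)) (δ ∘ fun r => e (u r)) z
      rw [funext (rightSlots_map hp (a ∘ σ) (fun r => e (u r)) δ)] at this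
      exact this
    have hprod := (hasDerivAt_line hφ
        (leftSlots k i (by omega) (a ∘ σ) (fun r => e (1 - β r)))
        (fun r => δ (leftSlots k i (by omega) (a ∘ σ) (fun r => e (1 - β r)) r))
        (leftSlots l j (by omega) (b ∘ τ) (fun r => e (1 - γ r)))
        (fun r => δ (leftSlots l j (by omega) (b ∘ τ) (fun r => e (1 - γ r)) r))).fun_mul
      (hasDerivAt_line hψ
        (rightSlots n i (by omega) (a ∘ σ) (fun r => e (β r)))
        (fun r => δ (rightSlots n i (by omega) (a ∘ σ) (fun r => e (β r)) r))
        (rightSlots m j (by omega) (b ∘ τ) (fun r => e (γ r)))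
        (fun r => δ (rightSlots m j (by omega) (b ∘ τ) (fun r => e (γ r)) r)))
    simp only [Complex.ofReal_zero, zero_smul, add_zero] at hprod
    refine hprod.congr_of_eventuallyEq (.of_forall fun z => ?_)
    exact congrArg₂ (· * ·)
      (congrArg₂ φ (hl _ a σ (fun r => 1 - β r) z) (hl _ b τ (fun r => 1 - γ r) z))
      (congrArg₂ ψ (hr _ a σ β z) (hr _ b τ γ z))
  have hX := contractSym_tensor_mem_span (e := e) (i := i) (j := j) (p := p) (q := q) hx hφ hψ
  -- The same function is a contraction in the fixed dyad scaled by the determinant of the moved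
  -- one; at `z = 0` the derivative of the determinant is the trace of `δ` on the dyad.
  have hR : HasDerivAt (fun z : ℝ => contractSym (e + (z : ℂ) • (δ ∘ e)) i j p q (tensor φ ψ)
      (a + (z : ℂ) • (δ ∘ a)) (b + (z : ℂ) • (δ ∘ b)))
      (((i * (x 0 (δ (e 0)) + x 1 (δ (e 1))) +
          j * starRingEnd ℂ (x 0 (δ (e 0)) + x 1 (δ (e 1)))) • contractSym e i j p q (tensor φ ψ) +
        slotDeriv δ (contractSym e i j p q (tensor φ ψ))) a b) 0 := by
    have hchange := fun z : ℝ => contractSym_tensor_change_dyad (i := i) (j := j) (p := p) (q := q)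
      hx (e + (z : ℂ) • (δ ∘ e)) hφ hψ
    simp_rw [hchange]
    have hlin : ∀ b c : ℂ, HasDerivAt (fun z : ℝ => b + (z : ℂ) * c) c 0 := fun b c => by
      simpa using ((Complex.ofRealCLM.hasDerivAt (x := (0 : ℝ))).mul_const c).const_add b
    have hD : HasDerivAt (fun z : ℝ =>
        x 0 ((e + (z : ℂ) • (δ ∘ e)) 0) * x 1 ((e + (z : ℂ) • (δ ∘ e)) 1) -
          x 1 ((e + (z : ℂ) • (δ ∘ e)) 0) * x 0 ((e + (z : ℂ) • (δ ∘ e)) 1))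
        (x 0 (δ (e 0)) + x 1 (δ (e 1))) 0 := by
      simp only [Pi.add_apply, Pi.smul_apply, Function.comp_apply, map_add, map_smul, smul_eq_mul,
        hxe]
      refine (((hlin _ _).fun_mul (hlin _ _)).fun_sub ((hlin _ _).fun_mul (hlin _ _))).congr_deriv
        ?_
      simp
    have hDc := hD.star
    have hline := hasDerivAt_line hX a (δ ∘ a) b (δ ∘ b)
    refine (((hD.fun_pow i).fun_mul (hDc.fun_pow j)).fun_mul hline).congr_deriv ?_
    simp [slotDeriv, hxe]
  exact hL.unique hR

end Derivation

/-! ### From one kind of index to two -/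

section Algebra

variable {V : Type*} [AddCommGroup V] [Module ℂ V] {e : Fin 2 → V} {x : Fin 2 → V →ₗ[ℂ] ℂ}
  {i j k l m n p q : ℕ}

/-- Expanding both arguments in the dyad gives four terms, each a coordinate and a conjugate
coordinate times a symmetric spinor, to which `IsSymSpinor.mem_span` applies. -/
theorem mem_span_powerDerivs (hx : ∀ s, ∑ b, x b s • e b = s) {D : V → V → RawSpinor V k l}
    (hadd : ∀ s s' t, D (s + s') t = D s t + D s' t)
    (hsmul : ∀ (c : ℂ) s t, D (c • s) t = c • D s t)
    (hadd' : ∀ s t t', D s (t + t') = D s t + D s t')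
    (hsmul' : ∀ (c : ℂ) s t, D s (c • t) = starRingEnd ℂ c • D s t)
    (hsym : ∀ s t, IsSymSpinor (D s t)) :
    (fun (a b : Fin 1 → V) => D (a 0) (b 0)) ∈ Submodule.span ℂ (powerDerivs V k l) := by
  have hsum : (fun (a b : Fin 1 → V) => D (a 0) (b 0)) = ∑ b, ∑ c,
      tensor (outer (power (x b) 1) (power (fun t => starRingEnd ℂ (x c t)) 1))
        (D (e b) (e c)) := by
    funext s t
    conv_lhs => rw [← hx (s 0), ← hx (t 0)]
    simp only [Fin.sum_univ_two, hadd, hadd', hsmul, hsmul']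
    funext c d
    simp [tensor_apply, outer, power, mul_assoc]
  rw [hsum]
  refine Submodule.sum_mem _ fun b _ => Submodule.sum_mem _ fun c _ => ?_
  have hD := (hsym (e b) (e c)).mem_span hx
  refine (Submodule.span_le (p := (Submodule.span ℂ (powerDerivs V k l)).comap
    (tensor (outer (power (x b) 1) (power (fun t => starRingEnd ℂ (x c t)) 1))))).2 ?_ hD
  rintro _ ⟨f, f', hf, hf', rfl⟩
  refine Submodule.subset_span ⟨x b, fun t => starRingEnd ℂ (x c t), f, f', ?_, ?_, hf, hf', rfl⟩
  · exact ⟨fun s t => map_add _ _ _, fun z s => by simp⟩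
  · exact ⟨fun s t => by simp, fun z s => by simp⟩

/-- The contraction of a derivative `F` of one factor of a symmetric product, bilinear in `F` and
the other factor. -/
def derivProduct (e : Fin 2 → V) (m n p q o o' P Q : ℕ) :
    ((Fin 1 → V) → (Fin 1 → V) → (Fin i → V) → (Fin j → V) → ℂ) →ₗ[ℂ] RawSpinor V k l →ₗ[ℂ]
      RawSpinor V P Q :=
  LinearMap.mk₂ ℂ (fun F G => contractSymₗ e o o' P Q
      fun s t => contractSymₗ e m n p q (tensor (F s t) G))
    (fun F F' G => by
      rw [← map_add]; congr 1; funext s t; simp only [Pi.add_apply, map_add, LinearMap.add_apply])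
    (fun c F G => by
      rw [← map_smul]; congr 1; funext s t
      simp only [Pi.smul_apply, map_smul, LinearMap.smul_apply])
    (fun F G G' => by
      rw [← map_add]; congr 1; funext s t; simp only [Pi.add_apply, map_add])
    (fun c F G => by
      rw [← map_smul]; congr 1; funext s t; simp only [Pi.smul_apply, map_smul])

/-- The symmetric product of a spinor with a fundamental derivative, as a bilinear map. -/
def productDeriv (e : Fin 2 → V) (m n o o' r s P Q : ℕ) :
    ((Fin 1 → V) → (Fin 1 → V) → (Fin i → V) → (Fin j → V) → ℂ) →ₗ[ℂ] RawSpinor V k l →ₗ[ℂ]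
      RawSpinor V P Q :=
  ((tensor (V := V)).compr₂ (contractSymₗ e m n P Q)).flip.comp (contractSymₗ e o o' r s)

/-- The Leibniz rule for two kinds of indices follows from the rules for each kind. -/
theorem derivProduct_eq {o o' P Q m₁ m₂ n₁ n₂ : ℕ}
    {u₁ u₂ v₁ v₂ : ℂ}
    (hU : ∀ a f g : V → ℂ, IsSemilinear (RingHom.id ℂ) a → IsSemilinear (RingHom.id ℂ) f →
      IsSemilinear (RingHom.id ℂ) g →
      contract1 e o P (power a 1) (contract1 e m p (power f i) (power g k)) =
        u₁ • contract1 e m₁ P (power g k) (contract1 e 0 (i + 1) (power a 1) (power f i)) +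
        u₂ • contract1 e m₂ P (power g k) (contract1 e 1 (i - 1) (power a 1) (power f i)))
    (hV : ∀ a f g : V → ℂ, IsSemilinear (starRingEnd ℂ) a → IsSemilinear (starRingEnd ℂ) f →
      IsSemilinear (starRingEnd ℂ) g →
      contract1 e o' Q (power a 1) (contract1 e n q (power f j) (power g l)) =
        v₁ • contract1 e n₁ Q (power g l) (contract1 e 0 (j + 1) (power a 1) (power f j)) +
        v₂ • contract1 e n₂ Q (power g l) (contract1 e 1 (j - 1) (power a 1) (power f j)))
    {F : (Fin 1 → V) → (Fin 1 → V) → (Fin i → V) → (Fin j → V) → ℂ}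
    (hF : F ∈ Submodule.span ℂ (powerDerivs V i j)) {G : RawSpinor V k l}
    (hG : G ∈ Submodule.span ℂ (powerSpinors V k l)) :
    contractSym e o o' P Q (fun s t => contractSym e m n p q (tensor (F s t) G)) =
      (u₁ * v₁) • contractSym e m₁ n₁ P Q (tensor G (contractSym e 0 0 (i + 1) (j + 1) F)) +
      (u₁ * v₂) • contractSym e m₁ n₂ P Q (tensor G (contractSym e 0 1 (i + 1) (j - 1) F)) +
      (u₂ * v₁) • contractSym e m₂ n₁ P Q (tensor G (contractSym e 1 0 (i - 1) (j + 1) F)) +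
      (u₂ * v₂) • contractSym e m₂ n₂ P Q (tensor G (contractSym e 1 1 (i - 1) (j - 1) F)) := by
  refine bilinear_eq_of_mem_span (derivProduct e m n p q o o' P Q)
    ((u₁ * v₁) • productDeriv e m₁ n₁ 0 0 (i + 1) (j + 1) P Q +
      (u₁ * v₂) • productDeriv e m₁ n₂ 0 1 (i + 1) (j - 1) P Q +
      (u₂ * v₁) • productDeriv e m₂ n₁ 1 0 (i - 1) (j + 1) P Q +
      (u₂ * v₂) • productDeriv e m₂ n₂ 1 1 (i - 1) (j - 1) P Q) ?_ hF hG
  rintro _ ⟨a, a', f, f', ha, ha', hf, hf', rfl⟩ _ ⟨g, g', hg, hg', rfl⟩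
  -- At fixed `s`, `t` the covector pair is a scalar for the inner contraction and passes through
  -- it.
  have hpull : ∀ s t, contractSym e m n p q (tensor
      (tensor (outer (power a 1) (power a' 1)) (outer (power f i) (power f' j)) s t)
      (outer (power g k) (power g' l))) = tensor (outer (power a 1) (power a' 1))
        (contractSym e m n p q
          (tensor (outer (power f i) (power f' j)) (outer (power g k) (power g' l)))) s t := by
    intro s t
    have h1 : tensor (outer (power a 1) (power a' 1)) (outer (power f i) (power f' j)) s t =
        outer (power a 1) (power a' 1) s t • outer (power f i) (power f' j) := rfl
    rw [h1, map_smul, LinearMap.smul_apply]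
    exact (contractSymₗ e m n p q).map_smul _ _
  change contractSym e o o' P Q (fun s t => contractSym e m n p q (tensor
      (tensor (outer (power a 1) (power a' 1)) (outer (power f i) (power f' j)) s t)
      (outer (power g k) (power g' l)))) =
    (u₁ * v₁) • contractSym e m₁ n₁ P Q (tensor _ (contractSym e 0 0 (i + 1) (j + 1) _)) +
      (u₁ * v₂) • contractSym e m₁ n₂ P Q (tensor _ (contractSym e 0 1 (i + 1) (j - 1) _)) +
      (u₂ * v₁) • contractSym e m₂ n₁ P Q (tensor _ (contractSym e 1 0 (i - 1) (j + 1) _)) +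
      (u₂ * v₂) • contractSym e m₂ n₂ P Q (tensor _ (contractSym e 1 1 (i - 1) (j - 1) _))
  simp only [funext fun s => funext fun t => hpull s t, contractSym_tensor_outer]
  rw [hU a f g ha hf hg, hV a' f' g' ha' hf' hg']
  funext b c
  simp only [outer, Pi.add_apply, Pi.smul_apply, smul_eq_mul]
  ring

/-- `derivProduct_eq` for a derivative of the second factor. -/
theorem derivProduct_eq_right (hx : ∀ s, ∑ b, x b s • e b = s) {o o' P Q m₁ m₂ n₁ n₂ : ℕ}
    {u₁ u₂ v₁ v₂ : ℂ}
    (hU : ∀ a f g : V → ℂ, IsSemilinear (RingHom.id ℂ) a → IsSemilinear (RingHom.id ℂ) f →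
      IsSemilinear (RingHom.id ℂ) g →
      contract1 e o P (power a 1) (contract1 e m p (power f i) (power g k)) =
        u₁ • contract1 e m₁ P (power g k) (contract1 e 0 (i + 1) (power a 1) (power f i)) +
        u₂ • contract1 e m₂ P (power g k) (contract1 e 1 (i - 1) (power a 1) (power f i)))
    (hV : ∀ a f g : V → ℂ, IsSemilinear (starRingEnd ℂ) a → IsSemilinear (starRingEnd ℂ) f →
      IsSemilinear (starRingEnd ℂ) g →
      contract1 e o' Q (power a 1) (contract1 e n q (power f j) (power g l)) =
        v₁ • contract1 e n₁ Q (power g l) (contract1 e 0 (j + 1) (power a 1) (power f j)) +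
        v₂ • contract1 e n₂ Q (power g l) (contract1 e 1 (j - 1) (power a 1) (power f j)))
    {F : (Fin 1 → V) → (Fin 1 → V) → (Fin i → V) → (Fin j → V) → ℂ}
    (hF : F ∈ Submodule.span ℂ (powerDerivs V i j))
    (hF' : ∀ s t, F s t ∈ Submodule.span ℂ (powerSpinors V i j)) {G : RawSpinor V k l}
    (hG : G ∈ Submodule.span ℂ (powerSpinors V k l)) :
    contractSym e o o' P Q (fun s t => contractSym e m n p q (tensor G (F s t))) =
      (-1 : ℂ) ^ (m + n) •
      ((u₁ * v₁) • contractSym e m₁ n₁ P Q (tensor G (contractSym e 0 0 (i + 1) (j + 1) F)) +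
      (u₁ * v₂) • contractSym e m₁ n₂ P Q (tensor G (contractSym e 0 1 (i + 1) (j - 1) F)) +
      (u₂ * v₁) • contractSym e m₂ n₁ P Q (tensor G (contractSym e 1 0 (i - 1) (j + 1) F)) +
      (u₂ * v₂) • contractSym e m₂ n₂ P Q (tensor G (contractSym e 1 1 (i - 1) (j - 1) F))) := by
  rw [← derivProduct_eq hU hV hF hG]
  -- Exchanging the factors moves the differentiated one to the left, where `derivProduct_eq`
  -- applies.
  have hswap : (fun s t => contractSym e m n p q (tensor G (F s t))) =
      (-1 : ℂ) ^ (m + n) • fun s t => contractSym e m n p q (tensor (F s t) G) := by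
    funext s t
    exact contractSym_tensor_swap (i := m) (j := n) (p := p) (q := q) hx hG (hF' s t)
  rw [hswap]
  exact (contractSymₗ e o o' P Q).map_smul _ _

end Algebra

/-! ### Calculus of directional derivatives on the manifold -/

section DirDeriv

variable {M : Type*} [TopologicalSpace M] [ChartedSpace E4 M]

/-- `f` is differentiable at `x` and its derivative along `v` is `d`. -/
def HasDirDeriv (x : M) (v : TangentSpace 𝓘(ℝ, E4) x) (f : M → ℂ) (d : ℂ) : Prop :=
  MDifferentiableAt 𝓘(ℝ, E4) 𝓘(ℝ, ℂ) f x ∧ mvfderiv 𝓘(ℝ, E4) f x v = d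

variable {x : M} {v : TangentSpace 𝓘(ℝ, E4) x} {f g : M → ℂ} {d d' : ℂ}

theorem _root_.MDifferentiableAt.hasDirDeriv (hf : MDifferentiableAt 𝓘(ℝ, E4) 𝓘(ℝ, ℂ) f x) :
    HasDirDeriv x v f (mvfderiv 𝓘(ℝ, E4) f x v) := ⟨hf, rfl⟩

namespace HasDirDeriv

theorem unique (h : HasDirDeriv x v f d) (h' : HasDirDeriv x v f d') : d = d' :=
  h.2.symm.trans h'.2

theorem congr_deriv (h : HasDirDeriv x v f d) (hd : d = d') : HasDirDeriv x v f d' := hd ▸ h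

theorem congr_of_eventuallyEq (h : HasDirDeriv x v f d) (hg : g =ᶠ[nhds x] f) :
    HasDirDeriv x v g d := by
  refine ⟨h.1.congr_of_eventuallyEq hg, ?_⟩
  rw [← h.2, mvfderiv, mvfderiv, hg.mfderiv_eq]
  rfl

theorem const (c : ℂ) : HasDirDeriv x v (fun _ => c) 0 := by
  refine ⟨mdifferentiableAt_const, ?_⟩
  rw [mvfderiv_const]
  rfl

theorem add (h : HasDirDeriv x v f d) (h' : HasDirDeriv x v g d') :
    HasDirDeriv x v (fun y => f y + g y) (d + d') := by
  refine ⟨h.1.add h'.1, ?_⟩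
  rw [mvfderiv_fun_add h.1 h'.1, ← h.2, ← h'.2]
  rfl

theorem mul (h : HasDirDeriv x v f d) (h' : HasDirDeriv x v g d') :
    HasDirDeriv x v (fun y => f y * g y) (d * g x + f x * d') := by
  refine ⟨h.1.mul h'.1, ?_⟩
  have := (h.1.hasMFDerivAt.mul h'.1.hasMFDerivAt).mfderiv
  rw [← h.2, ← h'.2]
  change mfderiv 𝓘(ℝ, E4) 𝓘(ℝ, ℂ) (f * g) x v = _
  rw [this]
  change f x * _ + g x * _ = _
  rw [add_comm, mul_comm (g x)]
  rfl

/-- `G` is differentiated over the reals so that complex conjugation is admitted. -/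
theorem comp {G : ℂ → ℂ} {G' : ℂ →L[ℝ] ℂ} (hG : HasFDerivAt G G' (f x))
    (h : HasDirDeriv x v f d) : HasDirDeriv x v (fun y => G (f y)) (G' d) := by
  have hc := HasMFDerivAt.comp x hG.hasMFDerivAt h.1.hasMFDerivAt
  refine ⟨hc.mdifferentiableAt, ?_⟩
  rw [← h.2]
  change mfderiv 𝓘(ℝ, E4) 𝓘(ℝ, ℂ) (G ∘ f) x v = _
  rw [hc.mfderiv]
  rfl

theorem const_mul (c : ℂ) (h : HasDirDeriv x v f d) :
    HasDirDeriv x v (fun y => c * f y) (c * d) :=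
  ((const c).mul h).congr_deriv (by ring)

theorem conj (h : HasDirDeriv x v f d) :
    HasDirDeriv x v (fun y => starRingEnd ℂ (f y)) (starRingEnd ℂ d) :=
  h.comp (G := fun z => starRingEnd ℂ z) Complex.conjCLE.hasFDerivAt

theorem comp_deriv {G : ℂ → ℂ} {G' : ℂ} (hG : HasDerivAt G G' (f x))
    (h : HasDirDeriv x v f d) : HasDirDeriv x v (fun y => G (f y)) (G' * d) :=
  (h.comp (hG.hasFDerivAt.restrictScalars ℝ)).congr_deriv (by simp [mul_comm])

theorem sum {ι : Type*} (s : Finset ι) {f : ι → M → ℂ} {d : ι → ℂ}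
    (h : ∀ i ∈ s, HasDirDeriv x v (f i) (d i)) :
    HasDirDeriv x v (fun y => ∑ i ∈ s, f i y) (∑ i ∈ s, d i) := by
  classical
  induction s using Finset.induction_on with
  | empty => simpa using const 0
  | insert a s ha ih =>
    simp only [Finset.sum_insert ha]
    exact (h a (Finset.mem_insert_self _ _)).add
      (ih fun i hi => h i (Finset.mem_insert_of_mem hi))

end HasDirDeriv

end DirDeriv

/-! ### Symmetric spinors obtained from families -/

section SymSpinorFamilies

variable {V W : Type*} [AddCommGroup V] [Module ℂ V] [AddCommGroup W] [Module ℂ W] {k l : ℕ}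

/-- Pullback of a symmetric spinor along a linear map. -/
theorem IsSymSpinor.comp_linear {φ : RawSpinor W k l} (hφ : IsSymSpinor φ) (L : V →ₗ[ℂ] W) :
    IsSymSpinor fun (a : Fin k → V) (b : Fin l → V) => φ (L ∘ a) (L ∘ b) where
  map_add a b r s t := by simp only [Function.comp_update, L.map_add, hφ.map_add]
  map_smul a b r c s := by simp only [Function.comp_update, L.map_smul, hφ.map_smul]
  map_add' a b r s t := by simp only [Function.comp_update, L.map_add, hφ.map_add']
  map_smul' a b r c s := by simp only [Function.comp_update, L.map_smul, hφ.map_smul']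
  symm a b σ τ := by simp only [← Function.comp_assoc, hφ.symm]

/-- A linear operation on functions of a parameter takes a family of symmetric spinors to a
symmetric spinor. -/
theorem isSymSpinor_of_family {X : Type*} {R : (X → ℂ) → ℂ → Prop}
    (hadd : ∀ f g d d', R f d → R g d' → R (fun z => f z + g z) (d + d'))
    (hmul : ∀ f d (c : ℂ), R f d → R (fun z => c * f z) (c * d))
    (huniq : ∀ f d d', R f d → R f d' → d = d') {Φ : X → RawSpinor V k l} {Ψ : RawSpinor V k l}
    (hΦ : ∀ z, IsSymSpinor (Φ z)) (h : ∀ a b, R (fun z => Φ z a b) (Ψ a b)) : IsSymSpinor Ψ where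
  map_add a b r s t := by
    have h1 := h (Function.update a r (s + t)) b
    simp only [(hΦ _).map_add] at h1
    exact huniq _ _ _ h1 (hadd _ _ _ _ (h _ _) (h _ _))
  map_smul a b r c s := by
    have h1 := h (Function.update a r (c • s)) b
    simp only [(hΦ _).map_smul] at h1
    exact huniq _ _ _ h1 (hmul _ _ _ (h _ _))
  map_add' a b r s t := by
    have h1 := h a (Function.update b r (s + t))
    simp only [(hΦ _).map_add'] at h1
    exact huniq _ _ _ h1 (hadd _ _ _ _ (h _ _) (h _ _))
  map_smul' a b r c s := by
    have h1 := h a (Function.update b r (c • s))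
    simp only [(hΦ _).map_smul'] at h1
    exact huniq _ _ _ h1 (hmul _ _ _ (h _ _))
  symm a b σ τ := by
    have h1 := h (a ∘ σ) (b ∘ τ)
    simp only [(hΦ _).symm] at h1
    exact huniq _ _ _ h1 (h _ _)

/-- The slotwise action of `δ` is the derivative at `z = 0` of the pullbacks of `φ` along `id + z
δ`, which are symmetric spinors. -/
theorem IsSymSpinor.slotDeriv {e : Fin 2 → V} {x : Fin 2 → V →ₗ[ℂ] ℂ}
    (hx : ∀ s, ∑ b, x b s • e b = s) {φ : RawSpinor V k l} (hφ : IsSymSpinor φ)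
    (δ : V →ₗ[ℂ] V) : IsSymSpinor (slotDeriv δ φ) :=
  isSymSpinor_of_family (X := ℝ) (R := fun f d => HasDerivAt f d 0)
    (fun _ _ _ _ h h' => h.fun_add h') (fun _ _ c h => h.const_mul c)
    (fun _ _ _ h h' => h.unique h')
    (fun z => hφ.comp_linear (LinearMap.id + (z : ℂ) • δ))
    (fun a b => by
      have h : ∀ {n : ℕ} (c : Fin n → V) (z : ℝ),
          ⇑(LinearMap.id + (z : ℂ) • δ : V →ₗ[ℂ] V) ∘ c = c + (z : ℂ) • (δ ∘ c) := fun c z => rfl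
      simp only [h]
      exact hasDerivAt_line (hφ.mem_span hx) a (δ ∘ a) b (δ ∘ b))

end SymSpinorFamilies

/-! ### Local extension of spin vectors -/

section Bundles

variable {M : Type*} [TopologicalSpace M]
  {S : M → Type*} [TopologicalSpace (TotalSpace C2 S)]
  [∀ x, AddCommGroup (S x)] [∀ x, Module ℂ (S x)] [∀ x, TopologicalSpace (S x)]
  [FiberBundle C2 S] [VectorBundle ℂ C2 S]

/-- The extension of spin vectors at `x`, evaluated at `y` near `x`, as a linear map. -/
def extendₗ (x y : M) : S x →ₗ[ℂ] S y :=
  (trivializationAt C2 S x).symmₗ ℂ y ∘ₗ (trivializationAt C2 S x).linearMapAt ℂ x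

/-- Extension is transport through one trivialization, which is linear over its base set; agreement
near `x` is all that derivatives at `x` require. -/
theorem eventually_extendₗ (x : M) :
    ∀ᶠ y in nhds x, ∀ s : S x, extendₗ x y s = FiberBundle.extend C2 s y := by
  have hx := FiberBundle.mem_baseSet_trivializationAt' (F := C2) (E := S) x
  filter_upwards [(trivializationAt C2 S x).open_baseSet.mem_nhds hx] with y hy s
  simp [extendₗ, FiberBundle.extend, hx, hy]

theorem finrank_fiber (x : M) : Module.finrank ℂ (S x) = 2 := by
  have hx := FiberBundle.mem_baseSet_trivializationAt' (F := C2) (E := S) x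
  rw [((trivializationAt C2 S x).linearEquivAt ℂ x hx).finrank_eq]
  simp

end Bundles

/-! ### Spin dyads and the covariant derivative of spinor fields -/

section Spacetime

set_option linter.unusedSectionVars false

variable {M : Type*} [TopologicalSpace M] [ChartedSpace E4 M] [IsManifold 𝓘(ℝ, E4) ∞ M]
  {S : M → Type*} [TopologicalSpace (TotalSpace C2 S)]
  [∀ x, AddCommGroup (S x)] [∀ x, Module ℂ (S x)] [∀ x, TopologicalSpace (S x)]
  [∀ x, IsTopologicalAddGroup (S x)] [∀ x, ContinuousSMul ℝ (S x)]
  [FiberBundle C2 S] [VectorBundle ℂ C2 S] [VectorBundle ℝ C2 S]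
  [ContMDiffVectorBundle ∞ C2 S 𝓘(ℝ, E4)]
  {g : LorentzMetric M} {𝔖 : SpinStructure g S}

theorem smoothAt_extend {x : M} (s : S x) : SmoothAt (FiberBundle.extend C2 s) x :=
  FiberBundle.contMDiffAt_extend (k := ∞) 𝓘(ℝ, E4) C2 s

theorem SmoothAt.diffAt {x : M} {s : ∀ y, S y} (hs : SmoothAt s x) : DiffAt s x :=
  ContMDiffAt.mdifferentiableAt hs (by simp)

theorem diffAt_extend {x : M} (s : S x) : DiffAt (FiberBundle.extend C2 s) x :=
  (smoothAt_extend s).diffAt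

theorem DiffAt.congr {x : M} {s t : ∀ y, S y} (hs : DiffAt s x) (h : ∀ᶠ y in nhds x, s y = t y) :
    DiffAt t x := by
  refine MDifferentiableAt.congr_of_eventuallyEq hs ?_
  filter_upwards [h] with y hy
  rw [hy]

/-- The components of a spin vector along the spin dyad. -/
def SpinStructure.coord (𝔖 : SpinStructure g S) (x : M) : Fin 2 → S x →ₗ[ℂ] ℂ :=
  ![(𝔖.eps x).flip (𝔖.dyad x 1), 𝔖.eps x (𝔖.dyad x 0)]

theorem SpinStructure.eps_swap (𝔖 : SpinStructure g S) (x : M) (s t : S x) :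
    𝔖.eps x s t = -𝔖.eps x t s := by
  have h := 𝔖.eps_self x (s + t)
  simp only [map_add, LinearMap.add_apply, 𝔖.eps_self, zero_add, add_zero] at h
  exact eq_neg_of_add_eq_zero_right h

theorem SpinStructure.coord_dyad (𝔖 : SpinStructure g S) (x : M) (b c : Fin 2) :
    𝔖.coord x b (𝔖.dyad x c) = if b = c then 1 else 0 := by
  fin_cases b <;> fin_cases c <;>
    simp [SpinStructure.coord, 𝔖.eps_dyad, 𝔖.eps_self]

/-- The dyad is independent by duality with `coord`, and the fibre has dimension two. -/
theorem SpinStructure.sum_coord (𝔖 : SpinStructure g S) (x : M) (s : S x) :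
    ∑ b, 𝔖.coord x b s • 𝔖.dyad x b = s := by
  have hli : LinearIndependent ℂ (𝔖.dyad x) := by
    rw [Fintype.linearIndependent_iff]
    intro c hc b
    have := congrArg (𝔖.coord x b) hc
    fin_cases b <;> simpa [𝔖.coord_dyad] using this
  have hspan := hli.span_eq_top_of_card_eq_finrank (by
    rw [finrank_fiber x, Fintype.card_fin])
  have hs : s ∈ Submodule.span ℂ (Set.range (𝔖.dyad x)) := hspan ▸ Submodule.mem_top
  obtain ⟨c, rfl⟩ := (Submodule.mem_span_range_iff_exists_fun ℂ).1 hs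
  simp [𝔖.coord_dyad]

/-- This identifies the determinant in a change of dyad with `ε` of the new dyad, whose derivative
is controlled by `eps_parallel`. -/
theorem SpinStructure.eps_eq_det (𝔖 : SpinStructure g S) (x : M) (s t : S x) :
    𝔖.eps x s t = 𝔖.coord x 0 s * 𝔖.coord x 1 t - 𝔖.coord x 1 s * 𝔖.coord x 0 t := by
  conv_lhs => rw [← 𝔖.sum_coord x s, ← 𝔖.sum_coord x t]
  simp only [Fin.sum_univ_two, map_add, map_smul, LinearMap.add_apply, LinearMap.smul_apply,
    𝔖.eps_self, 𝔖.eps_dyad, 𝔖.eps_swap x (𝔖.dyad x 1) (𝔖.dyad x 0), smul_eq_mul]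
  ring

namespace LeviCivita

variable (nab : LeviCivita 𝔖)

theorem covS_congr {x : M} {s t : ∀ y, S y} (hs : DiffAt s x) (h : ∀ᶠ y in nhds x, s y = t y) :
    nab.covS s x = nab.covS t x :=
  nab.covS.isCovariantDerivativeOnUniv.congr_of_eventuallyEq hs (hs.congr h) Filter.univ_mem h

/-- The covariant derivative of the extensions of spin vectors. -/
def covExtend (x : M) (v : TangentSpace 𝓘(ℝ, E4) x) : S x →ₗ[ℂ] S x where
  toFun s := nab.covS (FiberBundle.extend C2 s) x v
  map_add' s t := by
    rw [nab.covS_congr (diffAt_extend (s + t))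
      (t := FiberBundle.extend C2 s + FiberBundle.extend C2 t),
      nab.covS.isCovariantDerivativeOnUniv.add (diffAt_extend s) (diffAt_extend t)]
    · rfl
    · filter_upwards [eventually_extendₗ (S := S) x] with y hy
      rw [← hy, map_add, hy, hy]
      rfl
  map_smul' c s := by
    -- The connection is real linear by type; complex linearity comes from `map_I` after splitting
    -- `c` into real and imaginary parts.
    have hI : nab.covS (FiberBundle.extend C2 (Complex.I • s)) x v =
        Complex.I • nab.covS (FiberBundle.extend C2 s) x v := by
      rw [nab.covS_congr (diffAt_extend (Complex.I • s))
        (t := fun y => Complex.I • FiberBundle.extend C2 s y), nab.map_I _ _ _ (diffAt_extend s)]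
      filter_upwards [eventually_extendₗ (S := S) x] with y hy
      rw [← hy, map_smul, hy]
    have hR : ∀ (r : ℝ) (s : S x), DiffAt (r • FiberBundle.extend C2 s) x ∧
        nab.covS (r • FiberBundle.extend C2 s) x v =
          (r : ℂ) • nab.covS (FiberBundle.extend C2 s) x v := by
      intro r s
      refine ⟨(diffAt_extend ((r : ℂ) • s)).congr ?_, ?_⟩
      · filter_upwards [eventually_extendₗ (S := S) x] with y hy
        rw [← hy, map_smul, hy]
        rfl
      · rw [nab.covS.isCovariantDerivativeOnUniv.smul_const r (diffAt_extend s)]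
        rfl
    rw [nab.covS_congr (diffAt_extend (c • s)) (t := c.re • FiberBundle.extend C2 s +
        c.im • FiberBundle.extend C2 (Complex.I • s)),
      nab.covS.isCovariantDerivativeOnUniv.add (hR _ _).1 (hR _ _).1]
    · rw [add_apply, (hR _ _).2, (hR _ _).2, hI, smul_smul, ← add_smul,
        Complex.re_add_im]
      rfl
    · filter_upwards [eventually_extendₗ (S := S) x] with y hy
      rw [Pi.add_apply, Pi.smul_apply, Pi.smul_apply, ← hy, ← hy, ← hy, map_smul, map_smul,
        ← Complex.coe_smul, ← Complex.coe_smul, smul_smul, ← add_smul, Complex.re_add_im]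

variable {k l : ℕ}

/-- The derivative of the components of a spinor field along extended spin vectors. -/
theorem hasDirDeriv_extend {φ : RawField S k l} (hφ : IsSymSpinorField φ) (x : M)
    (v : TangentSpace 𝓘(ℝ, E4) x) (a : Fin k → S x) (b : Fin l → S x) :
    HasDirDeriv x v (fun y => φ y (fun r => FiberBundle.extend C2 (a r) y)
      (fun r => FiberBundle.extend C2 (b r) y))
      (nab.covDeriv φ x v a b + slotDeriv (nab.covExtend x v) (φ x) a b) := by
  have h := (hφ.smooth (fun r => FiberBundle.extend C2 (a r)) (fun r => FiberBundle.extend C2 (b r))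
    x (fun r => smoothAt_extend _) (fun r => smoothAt_extend _)).mdifferentiableAt (by simp)
  refine (h.hasDirDeriv (v := v)).congr_deriv ?_
  simp only [covDeriv, slotDeriv, covExtend, LinearMap.coe_mk, AddHom.coe_mk]
  ring

/-- Before the slot corrections, the derivative is that of the pullbacks of `φ y` to the fibre over
`x` along `extendₗ`, a family of symmetric spinors on a fixed space. The corrections form a
symmetric spinor by `IsSymSpinor.slotDeriv`. -/
theorem isSymSpinor_covDeriv {φ : RawField S k l} (hφ : IsSymSpinorField φ) (x : M)
    (v : TangentSpace 𝓘(ℝ, E4) x) : IsSymSpinor (nab.covDeriv φ x v) := by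
  have h1 : IsSymSpinor (nab.covDeriv φ x v + slotDeriv (nab.covExtend x v) (φ x)) := by
    refine isSymSpinor_of_family (X := M) (R := HasDirDeriv x v)
      (fun _ _ _ _ h h' => h.add h') (fun _ _ c h => h.const_mul c)
      (fun _ _ _ h h' => h.unique h')
      (fun y => (hφ.isSymSpinor y).comp_linear (extendₗ x y)) fun a b => ?_
    refine (nab.hasDirDeriv_extend hφ x v a b).congr_of_eventuallyEq ?_
    filter_upwards [eventually_extendₗ (S := S) x] with y hy
    simp only [Function.comp_def, hy]
  have h2 := (hφ.isSymSpinor x).slotDeriv (𝔖.sum_coord x) (nab.covExtend x v)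
  have := h1.add (h2.smul (-1))
  convert this using 1
  simp

theorem covDeriv_add_vector {φ : RawField S k l} (hφ : IsSymSpinorField φ) (x : M)
    (v w : TangentSpace 𝓘(ℝ, E4) x) :
    nab.covDeriv φ x (v + w) = nab.covDeriv φ x v + nab.covDeriv φ x w := by
  funext a b
  simp only [covDeriv, Pi.add_apply, map_add, (hφ.isSymSpinor x).map_add,
    (hφ.isSymSpinor x).map_add', Finset.sum_add_distrib]
  ring

theorem covDeriv_smul_vector {φ : RawField S k l} (hφ : IsSymSpinorField φ) (x : M)
    (r : ℝ) (v : TangentSpace 𝓘(ℝ, E4) x) :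
    nab.covDeriv φ x (r • v) = (r : ℂ) • nab.covDeriv φ x v := by
  funext a b
  simp only [covDeriv, Pi.smul_apply, map_smul, ← Complex.coe_smul, (hφ.isSymSpinor x).map_smul,
    (hφ.isSymSpinor x).map_smul', Complex.conj_ofReal, smul_eq_mul, ← Finset.mul_sum]
  ring

end LeviCivita

end Spacetime

theorem contractSym_add {V : Type*} (e : Fin 2 → V) {k l n m : ℕ} (i j p q : ℕ)
    (T T' : (Fin k → V) → (Fin l → V) → (Fin n → V) → (Fin m → V) → ℂ) :
    contractSym e i j p q (T + T') = contractSym e i j p q T + contractSym e i j p q T' :=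
  (contractSymₗ e i j p q).map_add T T'

/-! ### Product rule for the covariant derivative of a symmetric product -/

section Leibniz

set_option linter.unusedSectionVars false

variable {M : Type*} [TopologicalSpace M] [ChartedSpace E4 M] [IsManifold 𝓘(ℝ, E4) ∞ M]
  {S : M → Type*} [TopologicalSpace (TotalSpace C2 S)]
  [∀ x, AddCommGroup (S x)] [∀ x, Module ℂ (S x)] [∀ x, TopologicalSpace (S x)]
  [∀ x, IsTopologicalAddGroup (S x)] [∀ x, ContinuousSMul ℝ (S x)]
  [FiberBundle C2 S] [VectorBundle ℂ C2 S] [VectorBundle ℝ C2 S]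
  [ContMDiffVectorBundle ∞ C2 S 𝓘(ℝ, E4)]
  {g : LorentzMetric M} {𝔖 : SpinStructure g S}

theorem HasDirDeriv.pow {x : M} {v : TangentSpace 𝓘(ℝ, E4) x} {f : M → ℂ} {d : ℂ}
    (h : HasDirDeriv x v f d) (n : ℕ) :
    HasDirDeriv x v (fun y => f y ^ n) (n * f x ^ (n - 1) * d) :=
  h.comp_deriv (hasDerivAt_pow n (f x))

namespace LeviCivita

variable (nab : LeviCivita 𝔖) {i j k l p q m n : ℕ}

/-- Product rule for a contraction with respect to an extended dyad. -/
theorem hasDirDeriv_contractSym {φ : RawField S i j} (hφ : IsSymSpinorField φ) {ψ : RawField S k l}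
    (hψ : IsSymSpinorField ψ) (x : M) (v : TangentSpace 𝓘(ℝ, E4) x) (e : Fin 2 → S x)
    (a : Fin p → S x) (b : Fin q → S x) :
    HasDirDeriv x v (fun y => contractSym (fun c => FiberBundle.extend C2 (e c) y) m n p q
        (tensor (φ y) (ψ y)) (fun r => FiberBundle.extend C2 (a r) y)
        (fun r => FiberBundle.extend C2 (b r) y))
      (contractSym e m n p q
        (tensor (nab.covDeriv φ x v + slotDeriv (nab.covExtend x v) (φ x)) (ψ x) +
          tensor (φ x) (nab.covDeriv ψ x v + slotDeriv (nab.covExtend x v) (ψ x))) a b) := by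
  by_cases h : (m ≤ i ∧ m ≤ k ∧ p + 2 * m = i + k) ∧ (n ≤ j ∧ n ≤ l ∧ q + 2 * n = j + l)
  swap
  · simpa [contractSym, h] using HasDirDeriv.const 0
  simp only [contractSym_of_valence h]
  refine HasDirDeriv.const_mul _ (HasDirDeriv.sum _ fun σ _ => HasDirDeriv.sum _ fun τ _ =>
    HasDirDeriv.sum _ fun β _ => HasDirDeriv.sum _ fun γ _ => HasDirDeriv.const_mul _ ?_)
  have hl : ∀ {p k i : ℕ} (hp : k - i ≤ p) (a : Fin p → S x) (σ : Equiv.Perm (Fin p))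
      (u : Fin i → Fin 2) (y : M), leftSlots k i hp ((fun r => FiberBundle.extend C2 (a r) y) ∘ σ)
        (fun r => FiberBundle.extend C2 (e (u r)) y) =
      fun r => FiberBundle.extend C2 (leftSlots k i hp (a ∘ σ) (fun r => e (u r)) r) y :=
    fun hp a σ u y => funext (leftSlots_map hp (a ∘ σ) (fun r => e (u r))
      (fun s => FiberBundle.extend C2 s y))
  have hr : ∀ {p k i : ℕ} (hp : k - i ≤ p) (a : Fin p → S x) (σ : Equiv.Perm (Fin p))
      (u : Fin i → Fin 2) (y : M), rightSlots k i hp ((fun r => FiberBundle.extend C2 (a r) y) ∘ σ)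
        (fun r => FiberBundle.extend C2 (e (u r)) y) =
      fun r => FiberBundle.extend C2 (rightSlots k i hp (a ∘ σ) (fun r => e (u r)) r) y :=
    fun hp a σ u y => funext (rightSlots_map hp (a ∘ σ) (fun r => e (u r))
      (fun s => FiberBundle.extend C2 s y))
  simp only [tensor_apply, Pi.add_apply]
  have h1 := (nab.hasDirDeriv_extend hφ x v
      (leftSlots i m (by omega) (a ∘ σ) (fun r => e (1 - β r)))
      (leftSlots j n (by omega) (b ∘ τ) (fun r => e (1 - γ r)))).mul
    (nab.hasDirDeriv_extend hψ x v
      (rightSlots k m (by omega) (a ∘ σ) (fun r => e (β r)))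
      (rightSlots l n (by omega) (b ∘ τ) (fun r => e (γ r))))
  simp only [FiberBundle.extend_apply_self] at h1
  refine h1.congr_of_eventuallyEq (.of_forall fun y => ?_)
  exact congrArg₂ (· * ·)
    (congrArg₂ (φ y) (hl _ a σ (fun r => 1 - β r) y) (hl _ b τ (fun r => 1 - γ r) y))
    (congrArg₂ (ψ y) (hr _ a σ β y) (hr _ b τ γ y))

/-- The derivative of the volume of the extended spin dyad. -/
theorem hasDirDeriv_eps (x : M) (v : TangentSpace 𝓘(ℝ, E4) x) :
    HasDirDeriv x v (fun y => 𝔖.eps y (FiberBundle.extend C2 (𝔖.dyad x 0) y)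
        (FiberBundle.extend C2 (𝔖.dyad x 1) y))
      (𝔖.coord x 0 (nab.covExtend x v (𝔖.dyad x 0)) +
        𝔖.coord x 1 (nab.covExtend x v (𝔖.dyad x 1))) := by
  have h := (𝔖.eps_smooth _ _ x (smoothAt_extend (𝔖.dyad x 0))
    (smoothAt_extend (𝔖.dyad x 1))).mdifferentiableAt (by simp)
  refine (h.hasDirDeriv (v := v)).congr_deriv ?_
  rw [nab.eps_parallel _ _ x v (diffAt_extend _) (diffAt_extend _)]
  simp only [FiberBundle.extend_apply_self]
  rfl

/-- The symmetric product satisfies the product rule for the covariant derivative. -/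
theorem covDeriv_prod {φ : RawField S i j} (hφ : IsSymSpinorField φ) {ψ : RawField S k l}
    (hψ : IsSymSpinorField ψ) (x : M) (v : TangentSpace 𝓘(ℝ, E4) x) :
    nab.covDeriv (𝔖.prod m n φ ψ : RawField S p q) x v =
      contractSym (𝔖.dyad x) m n p q (tensor (nab.covDeriv φ x v) (ψ x)) +
      contractSym (𝔖.dyad x) m n p q (tensor (φ x) (nab.covDeriv ψ x v)) := by
  have hspan : ∀ {k l : ℕ} {φ : RawField S k l}, IsSymSpinorField φ →
      ∀ y, φ y ∈ Submodule.span ℂ (powerSpinors (S y) k l) :=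
    fun hφ y => (hφ.isSymSpinor y).mem_span (𝔖.sum_coord y)
  -- The dyads chosen at different points need not vary continuously. Near `x` the product is
  -- instead the contraction in the extension of the dyad at `x`, divided by `D ^ m` and by the
  -- `n`-th power of the conjugate of `D`.
  set D : M → ℂ := fun y => 𝔖.eps y (FiberBundle.extend C2 (𝔖.dyad x 0) y)
        (FiberBundle.extend C2 (𝔖.dyad x 1) y) with hDdef
  set tr : ℂ := 𝔖.coord x 0 (nab.covExtend x v (𝔖.dyad x 0)) +
        𝔖.coord x 1 (nab.covExtend x v (𝔖.dyad x 1)) with htr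
  have hD : HasDirDeriv x v D tr := nab.hasDirDeriv_eps x v
  have hDx : D x = 1 := by simp only [hDdef, FiberBundle.extend_apply_self, 𝔖.eps_dyad]
  have hne : ∀ᶠ y in nhds x, D y ≠ 0 :=
    hD.1.continuousAt.eventually_ne (by rw [hDx]; exact one_ne_zero)
  have hscale := HasDirDeriv.comp_deriv (G := fun z => z⁻¹)
    (f := fun y => D y ^ m * starRingEnd ℂ (D y) ^ n) (hasDerivAt_inv (by simp [hDx]))
    ((hD.pow m).mul (hD.conj.pow n))
  have hchange : ∀ y, contractSym (fun c => FiberBundle.extend C2 (𝔖.dyad x c) y) m n p q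
      (tensor (φ y) (ψ y)) = (D y ^ m * starRingEnd ℂ (D y) ^ n) •
        (𝔖.prod m n φ ψ : RawField S p q) y := by
    intro y
    rw [contractSym_tensor_change_dyad (𝔖.sum_coord y) _ (hspan hφ y) (hspan hψ y), hDdef]
    simp only [𝔖.eps_eq_det]
    rfl
  -- The trace terms produced here cancel against the derivative of the inverse scale at `x`, where
  -- `D = 1` and the derivative of `D` is `tr`. The remaining slot action is the correction
  -- contained in `covDeriv` of the product.
  have hslot := contractSym_slotDeriv (p := p) (q := q) (i := m) (j := n) (𝔖.sum_coord x)
    (𝔖.coord_dyad x) (nab.covExtend x v) (hspan hφ x) (hspan hψ x)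
  funext a b
  have h1 := hscale.mul (nab.hasDirDeriv_contractSym (m := m) (n := n) hφ hψ x v (𝔖.dyad x) a b)
  have h2 := h1.congr_of_eventuallyEq (g := fun y => (𝔖.prod m n φ ψ : RawField S p q) y
      (fun r => FiberBundle.extend C2 (a r) y) (fun r => FiberBundle.extend C2 (b r) y)) <| by
    filter_upwards [hne] with y hy
    rw [hchange]
    have : D y ^ m * starRingEnd ℂ (D y) ^ n ≠ 0 :=
      mul_ne_zero (pow_ne_zero _ hy) (pow_ne_zero _ ((map_ne_zero _).2 hy))
    simp only [Pi.smul_apply, smul_eq_mul]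
    rw [inv_mul_cancel_left₀ this]
  have h3 := h2.2
  have hcov : nab.covDeriv (𝔖.prod m n φ ψ : RawField S p q) x v a b =
      mvfderiv 𝓘(ℝ, E4) (fun y => (𝔖.prod m n φ ψ : RawField S p q) y
        (fun r => FiberBundle.extend C2 (a r) y) (fun r => FiberBundle.extend C2 (b r) y)) x v -
      slotDeriv (nab.covExtend x v) ((𝔖.prod m n φ ψ : RawField S p q) x) a b := by
    simp only [covDeriv, slotDeriv, covExtend, LinearMap.coe_mk, AddHom.coe_mk]
    ring
  rw [hcov, h3]
  have hsplit : tensor (nab.covDeriv φ x v + slotDeriv (nab.covExtend x v) (φ x)) (ψ x) +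
      tensor (φ x) (nab.covDeriv ψ x v + slotDeriv (nab.covExtend x v) (ψ x)) =
      (tensor (nab.covDeriv φ x v) (ψ x) + tensor (φ x) (nab.covDeriv ψ x v)) +
      (tensor (slotDeriv (nab.covExtend x v) (φ x)) (ψ x) +
        tensor (φ x) (slotDeriv (nab.covExtend x v) (ψ x))) := by
    simp only [map_add, LinearMap.add_apply]
    abel
  rw [hsplit, contractSym_add _ _ _ _ _ _ (_ + _), hslot, contractSym_add, ← htr]
  simp only [hDx, FiberBundle.extend_apply_self, Pi.add_apply, Pi.smul_apply, smul_eq_mul, map_one,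
    one_pow]
  change _ - slotDeriv _ (contractSym (𝔖.dyad x) m n p q (tensor (φ x) (ψ x))) a b = _
  ring

end LeviCivita

end Leibniz

/-! ### The one-kind identities in a form common to symmetrization and contraction -/

section OneKind

/-- The Leibniz rule for one kind of indices, for spinors which are powers of linear forms: the
contraction of `o` indices of a covector `a` with a symmetric product, expressed by the products of
one factor with the uncontracted and the contracted product of `a` with the other factor. -/
def PowerLeibniz.{u} (o m p P i k m₁ m₂ : ℕ) (u₁ u₂ : ℂ) : Prop :=
  ∀ (V : Type u) [AddCommGroup V] [Module ℂ V] (e : Fin 2 → V) (x : Fin 2 → V →ₗ[ℂ] ℂ),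
    (∀ s, ∑ b, x b s • e b = s) → ∀ (ρ : ℂ →+* ℂ) (a f g : V → ℂ),
    IsSemilinear ρ a → IsSemilinear ρ f → IsSemilinear ρ g →
      contract1 e o P (power a 1) (contract1 e m p (power f i) (power g k)) =
        u₁ • contract1 e m₁ P (power g k) (contract1 e 0 (i + 1) (power a 1) (power f i)) +
        u₂ • contract1 e m₂ P (power g k) (contract1 e 1 (i - 1) (power a 1) (power f i))

theorem powerLeibniz_zero {m p i k : ℕ} (hmi : m ≤ i) (hmk : m ≤ k) (hp : p + 2 * m = i + k) :
    PowerLeibniz 0 m p (p + 1) i k m (m - 1) ((-1) ^ m) ((-1) ^ m * m / (i + 1)) :=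
  fun _ _ _ _ x hx _ _ _ _ ha hf hg =>
    contract1_zero_contract1 (x := fun b => x b) hx ha hf hg hmi hmk hp

theorem powerLeibniz_one {m p i k : ℕ} (hmi : m ≤ i) (hmk : m ≤ k) (hp : p + 2 * m = i + k)
    (h : 0 < p) :
    PowerLeibniz 1 m p (p - 1) i k (m + 1) m ((-1) ^ (m + 1) * (k - m) / (i + k - 2 * m))
      ((-1) ^ m * (i - m) * (i + k - m + 1) / ((i + 1) * (i + k - 2 * m))) := by
  obtain ⟨p, rfl⟩ := Nat.exists_eq_add_of_le' h
  exact fun _ _ _ _ x hx _ _ _ _ ha hf hg =>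
    contract1_one_contract1 (x := fun b => x b) hx ha hf hg hmi hmk hp

end OneKind

/-! ### Spinor derivatives and the general Leibniz rule -/

section SpinDeriv

set_option linter.unusedSectionVars false

universe u v

variable {M : Type v} [TopologicalSpace M] [ChartedSpace E4 M] [IsManifold 𝓘(ℝ, E4) ∞ M]
  {S : M → Type u} [TopologicalSpace (TotalSpace C2 S)]
  [∀ x, AddCommGroup (S x)] [∀ x, Module ℂ (S x)] [∀ x, TopologicalSpace (S x)]
  [∀ x, IsTopologicalAddGroup (S x)] [∀ x, ContinuousSMul ℝ (S x)]
  [FiberBundle C2 S] [VectorBundle ℂ C2 S] [VectorBundle ℝ C2 S]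
  [ContMDiffVectorBundle ∞ C2 S 𝓘(ℝ, E4)]
  {g : LorentzMetric M} {𝔖 : SpinStructure g S}

theorem SpinStructure.sigma_smul_left (𝔖 : SpinStructure g S) (x : M) (c : ℂ) (s t : S x) :
    𝔖.sigma x (c • s) t = c.re • 𝔖.sigma x s t + c.im • 𝔖.sigma x (Complex.I • s) t := by
  conv_lhs => rw [← Complex.re_add_im c, add_smul, mul_smul, Complex.coe_smul, Complex.coe_smul]
  simp only [map_add, map_smul, LinearMap.add_apply, LinearMap.smul_apply]

/-- Together with `sigma_I` this makes `sigma s t - i sigma (i s) t` conjugate linear in `t`. -/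
theorem SpinStructure.sigma_I_right (𝔖 : SpinStructure g S) (x : M) (s t : S x) :
    𝔖.sigma x s (Complex.I • t) = -𝔖.sigma x (Complex.I • s) t := by
  rw [← 𝔖.sigma_I x s (Complex.I • t), smul_smul, Complex.I_mul_I, neg_one_smul, map_neg]

theorem SpinStructure.sigma_smul_right (𝔖 : SpinStructure g S) (x : M) (c : ℂ) (s t : S x) :
    𝔖.sigma x s (c • t) = c.re • 𝔖.sigma x s t + (-c.im) • 𝔖.sigma x (Complex.I • s) t := by
  conv_lhs => rw [← Complex.re_add_im c, add_smul, mul_smul, Complex.coe_smul, Complex.coe_smul]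
  rw [map_add, map_smul, map_smul, 𝔖.sigma_I_right, smul_neg, neg_smul]

namespace LeviCivita

variable (nab : LeviCivita 𝔖) {i j k l p q m n : ℕ}

theorem spinDeriv_eq (φ : RawField S k l) (x : M) (s t : S x) :
    nab.spinDeriv φ x s t = nab.covDeriv φ x (𝔖.sigma x s t) -
      Complex.I • nab.covDeriv φ x (𝔖.sigma x (Complex.I • s) t) := rfl

theorem isSymSpinor_spinDeriv {φ : RawField S k l} (hφ : IsSymSpinorField φ) (x : M) (s t : S x) :
    IsSymSpinor (nab.spinDeriv φ x s t) := by
  rw [spinDeriv_eq, sub_eq_add_neg, ← neg_smul]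
  exact (nab.isSymSpinor_covDeriv hφ x _).add ((nab.isSymSpinor_covDeriv hφ x _).smul _)

theorem covDeriv_combination {φ : RawField S k l} (hφ : IsSymSpinorField φ) (x : M) (r r' : ℝ)
    (v w : TangentSpace 𝓘(ℝ, E4) x) : nab.covDeriv φ x (r • v + r' • w) =
      (r : ℂ) • nab.covDeriv φ x v + (r' : ℂ) • nab.covDeriv φ x w := by
  rw [nab.covDeriv_add_vector hφ, nab.covDeriv_smul_vector hφ, nab.covDeriv_smul_vector hφ]

/-- The complex vector `sigma s t - i sigma (i s) t` is linear in `s` and conjugate linear in `t`,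
and `covDeriv` is real linear in the direction, so `∇_{AA'} φ` is a genuine tensor of valence `(1,
1)` with values in symmetric spinors. -/
theorem spinDeriv_mem_span {φ : RawField S k l} (hφ : IsSymSpinorField φ) (x : M) :
    (fun a b : Fin 1 → S x => nab.spinDeriv φ x (a 0) (b 0)) ∈
      Submodule.span ℂ (powerDerivs (S x) k l) := by
  refine mem_span_powerDerivs (𝔖.sum_coord x) (fun s s' t => ?_) (fun c s t => ?_)
    (fun s t t' => ?_) (fun c s t => ?_) (nab.isSymSpinor_spinDeriv hφ x)
  · simp only [spinDeriv_eq, smul_add, map_add, LinearMap.add_apply, nab.covDeriv_add_vector hφ]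
    abel
  · simp only [spinDeriv_eq]
    rw [smul_comm Complex.I c s, 𝔖.sigma_smul_left x c s t,
      𝔖.sigma_smul_left x c (Complex.I • s) t, smul_smul, Complex.I_mul_I,
      neg_one_smul, map_neg, LinearMap.neg_apply, smul_neg, ← neg_smul,
      nab.covDeriv_combination hφ, nab.covDeriv_combination hφ]
    funext a b
    simp only [Pi.add_apply, Pi.sub_apply, Pi.smul_apply, smul_eq_mul, Complex.ofReal_neg]
    conv_rhs => rw [← Complex.re_add_im c]
    linear_combination ((c.im : ℂ) * nab.covDeriv φ x (𝔖.sigma x (Complex.I • s) t) a b) *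
      Complex.I_mul_I
  · simp only [spinDeriv_eq, smul_add, map_add, nab.covDeriv_add_vector hφ]
    abel
  · simp only [spinDeriv_eq]
    rw [𝔖.sigma_smul_right, 𝔖.sigma_smul_right, smul_smul, Complex.I_mul_I,
      neg_one_smul, map_neg, LinearMap.neg_apply, smul_neg, ← neg_smul, neg_neg,
      nab.covDeriv_combination hφ, nab.covDeriv_combination hφ]
    funext a b
    simp only [Pi.add_apply, Pi.sub_apply, Pi.smul_apply, smul_eq_mul, Complex.ofReal_neg]
    conv_rhs => rw [← Complex.re_add_im c]
    simp only [map_add, map_mul, Complex.conj_ofReal, Complex.conj_I]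
    linear_combination (-(c.im : ℂ) * nab.covDeriv φ x (𝔖.sigma x (Complex.I • s) t) a b) *
      Complex.I_mul_I

/-- The product rule for the spinor derivative of a symmetric product. -/
theorem spinDeriv_prod {φ : RawField S i j} (hφ : IsSymSpinorField φ) {ψ : RawField S k l}
    (hψ : IsSymSpinorField ψ) (x : M) (s t : S x) :
    nab.spinDeriv (𝔖.prod m n φ ψ : RawField S p q) x s t =
      contractSym (𝔖.dyad x) m n p q (tensor (nab.spinDeriv φ x s t) (ψ x)) +
      contractSym (𝔖.dyad x) m n p q (tensor (φ x) (nab.spinDeriv ψ x s t)) := by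
  have hc : ∀ T, contractSym (k := i) (l := j) (n := k) (m := l) (𝔖.dyad x) m n p q T =
      contractSymₗ (𝔖.dyad x) m n p q T := fun T => rfl
  simp only [spinDeriv_eq, nab.covDeriv_prod hφ hψ, hc, map_sub, map_smul, LinearMap.sub_apply,
    LinearMap.smul_apply, smul_add]
  abel

/-- The Leibniz rule for the four fundamental operators. -/
theorem nablaProd_prod {φ : RawField S i j} (hφ : IsSymSpinorField φ) {ψ : RawField S k l}
    (hψ : IsSymSpinorField ψ) {o o' P Q m₁ m₂ n₁ n₂ : ℕ} {u₁ u₂ v₁ v₂ w₁ w₂ z₁ z₂ : ℂ}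
    {c₁ c₂ c₃ c₄ c₅ c₆ c₇ c₈ : ℂ}
    (hU : PowerLeibniz.{u} o m p P i k m₁ m₂ u₁ u₂) (hV : PowerLeibniz.{u} o' n q Q j l n₁ n₂ v₁ v₂)
    (hW : PowerLeibniz.{u} o m p P k i m₁ m₂ w₁ w₂) (hZ : PowerLeibniz.{u} o' n q Q l j n₁ n₂ z₁ z₂)
    (h₁ : c₁ = u₁ * v₁) (h₂ : c₂ = u₁ * v₂) (h₃ : c₃ = u₂ * v₁) (h₄ : c₄ = u₂ * v₂)
    (h₅ : c₅ = (-1) ^ (m + n) * (w₁ * z₁)) (h₆ : c₆ = (-1) ^ (m + n) * (w₁ * z₂))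
    (h₇ : c₇ = (-1) ^ (m + n) * (w₂ * z₁)) (h₈ : c₈ = (-1) ^ (m + n) * (w₂ * z₂)) :
    (nab.nablaProd o o' (𝔖.prod m n φ ψ : RawField S p q) : RawField S P Q) =
      c₁ • 𝔖.prod m₁ n₁ ψ (nab.twist φ) + c₂ • 𝔖.prod m₁ n₂ ψ (nab.curl φ) +
      c₃ • 𝔖.prod m₂ n₁ ψ (nab.curlDagger φ) + c₄ • 𝔖.prod m₂ n₂ ψ (nab.div φ) +
      c₅ • 𝔖.prod m₁ n₁ φ (nab.twist ψ) + c₆ • 𝔖.prod m₁ n₂ φ (nab.curl ψ) +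
      c₇ • 𝔖.prod m₂ n₁ φ (nab.curlDagger ψ) + c₈ • 𝔖.prod m₂ n₂ φ (nab.div ψ) := by
  subst h₁ h₂ h₃ h₄ h₅ h₆ h₇ h₈
  funext x
  have hx := 𝔖.sum_coord x
  -- `h1` treats the summand in which `φ` is differentiated, `h2` the one in which `ψ` is; both
  -- leave the undifferentiated factor on the left.
  have h1 := derivProduct_eq (hU (S x) _ _ hx _) (hV (S x) _ _ hx _)
    (nab.spinDeriv_mem_span hφ x) ((hψ.isSymSpinor x).mem_span hx)
  have h2 := derivProduct_eq_right hx (hW (S x) _ _ hx _) (hZ (S x) _ _ hx _)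
    (nab.spinDeriv_mem_span hψ x) (fun s t => (nab.isSymSpinor_spinDeriv hψ x _ _).mem_span hx)
    ((hφ.isSymSpinor x).mem_span hx)
  have h3 : (nab.nablaProd o o' (𝔖.prod m n φ ψ : RawField S p q) : RawField S P Q) x =
      contractSym (𝔖.dyad x) o o' P Q (fun (s t : Fin 1 → S x) => contractSym (𝔖.dyad x) m n p q
        (tensor (nab.spinDeriv φ x (s 0) (t 0)) (ψ x))) +
      contractSym (𝔖.dyad x) o o' P Q (fun (s t : Fin 1 → S x) => contractSym (𝔖.dyad x) m n p q
        (tensor (φ x) (nab.spinDeriv ψ x (s 0) (t 0)))) := by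
    rw [← contractSym_add]
    refine congrArg (contractSym (𝔖.dyad x) o o' P Q) ?_
    funext s t
    exact nab.spinDeriv_prod hφ hψ x (s 0) (t 0)
  rw [h3, h1, h2]
  simp only [smul_add, smul_smul, ← add_assoc]
  rfl

end LeviCivita

end SpinDeriv

end SymSpin

end

theorem mainTheorem4 {M : Type*} [TopologicalSpace M] [ChartedSpace SymSpin.E4 M]
    [IsManifold 𝓘(ℝ, SymSpin.E4) ∞ M]
    {S : M → Type*} [TopologicalSpace (TotalSpace SymSpin.C2 S)]
    [∀ x, AddCommGroup (S x)] [∀ x, Module ℂ (S x)] [∀ x, TopologicalSpace (S x)]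
    [∀ x, IsTopologicalAddGroup (S x)] [∀ x, ContinuousSMul ℝ (S x)]
    [FiberBundle SymSpin.C2 S] [VectorBundle ℂ SymSpin.C2 S] [VectorBundle ℝ SymSpin.C2 S]
    [ContMDiffVectorBundle ∞ SymSpin.C2 S 𝓘(ℝ, SymSpin.E4)]
    {g : SymSpin.LorentzMetric M} (𝔖 : SymSpin.SpinStructure g S) (nab : SymSpin.LeviCivita 𝔖)
    {i j k l : ℕ} (φ : SymSpin.RawField S i j) (hφ : SymSpin.IsSymSpinorField φ)
    (ϕ : SymSpin.RawField S k l) (hϕ : SymSpin.IsSymSpinorField ϕ)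
    (m n : ℕ) (hmi : m ≤ i) (hmk : m ≤ k) (hnj : n ≤ j) (hnl : n ≤ l)
    -- `(p, q)` is the valence of `φ ⊙^{m,n} ϕ`
    (p q : ℕ) (hp : p = i + k - 2 * m) (hq : q = j + l - 2 * n) :
    -- `𝒯 (φ ⊙^{m,n} ϕ)`
    (nab.twist (𝔖.prod m n φ ϕ : SymSpin.RawField S p q) =
        (-1 : ℂ) ^ (m + n) • 𝔖.prod m n ϕ (nab.twist φ)
      + ((-1 : ℂ) ^ (m + n) * n / (j + 1)) • 𝔖.prod m (n - 1) ϕ (nab.curl φ)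
      + ((-1 : ℂ) ^ (m + n) * m / (i + 1)) • 𝔖.prod (m - 1) n ϕ (nab.curlDagger φ)
      + ((-1 : ℂ) ^ (m + n) * m * n / ((i + 1) * (j + 1))) •
          𝔖.prod (m - 1) (n - 1) ϕ (nab.div φ)
      + 𝔖.prod m n φ (nab.twist ϕ)
      + ((n : ℂ) / (l + 1)) • 𝔖.prod m (n - 1) φ (nab.curl ϕ)
      + ((m : ℂ) / (k + 1)) • 𝔖.prod (m - 1) n φ (nab.curlDagger ϕ)
      + ((m : ℂ) * n / (k * l + k + l + 1)) • 𝔖.prod (m - 1) (n - 1) φ (nab.div ϕ)) ∧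
    -- `𝒞 (φ ⊙^{m,n} ϕ)`, where the product has at least one primed index
    (2 * n < j + l →
      nab.curl (𝔖.prod m n φ ϕ : SymSpin.RawField S p q) =
        ((-1 : ℂ) ^ (m + n + 1) * (l - n) / (j + l - 2 * n)) • 𝔖.prod m (n + 1) ϕ (nab.twist φ)
      + ((-1 : ℂ) ^ (m + n) * (j - n) * (j + l - n + 1) / ((j + 1) * (j + l - 2 * n))) •
          𝔖.prod m n ϕ (nab.curl φ)
      + ((-1 : ℂ) ^ (m + n + 1) * m * (l - n) / ((i + 1) * (j + l - 2 * n))) •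
          𝔖.prod (m - 1) (n + 1) ϕ (nab.curlDagger φ)
      + ((-1 : ℂ) ^ (m + n) * m * (j - n) * (j + l - n + 1) /
            ((i + 1) * (j + 1) * (j + l - 2 * n))) •
          𝔖.prod (m - 1) n ϕ (nab.div φ)
      - (((j : ℂ) - n) / (j + l - 2 * n)) • 𝔖.prod m (n + 1) φ (nab.twist ϕ)
      + (((l : ℂ) - n) * (j + l - n + 1) / ((l + 1) * (j + l - 2 * n))) •
          𝔖.prod m n φ (nab.curl ϕ)
      + ((m : ℂ) * (-j + n) / ((k + 1) * (j + l - 2 * n))) •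
          𝔖.prod (m - 1) (n + 1) φ (nab.curlDagger ϕ)
      + ((m : ℂ) * (l - n) * (j + l - n + 1) / ((k + 1) * (l + 1) * (j + l - 2 * n))) •
          𝔖.prod (m - 1) n φ (nab.div ϕ)) ∧
    -- `𝒞† (φ ⊙^{m,n} ϕ)`, where the product has at least one unprimed index
    (2 * m < i + k →
      nab.curlDagger (𝔖.prod m n φ ϕ : SymSpin.RawField S p q) =
        ((-1 : ℂ) ^ (m + n + 1) * (k - m) / (i + k - 2 * m)) • 𝔖.prod (m + 1) n ϕ (nab.twist φ)
      + ((-1 : ℂ) ^ (m + n + 1) * n * (k - m) / ((j + 1) * (i + k - 2 * m))) •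
          𝔖.prod (m + 1) (n - 1) ϕ (nab.curl φ)
      + ((-1 : ℂ) ^ (m + n) * (i - m) * (i + k - m + 1) / ((i + 1) * (i + k - 2 * m))) •
          𝔖.prod m n ϕ (nab.curlDagger φ)
      + ((-1 : ℂ) ^ (m + n) * n * (i - m) * (i + k - m + 1) /
            ((i + 1) * (j + 1) * (i + k - 2 * m))) •
          𝔖.prod m (n - 1) ϕ (nab.div φ)
      - (((i : ℂ) - m) / (i + k - 2 * m)) • 𝔖.prod (m + 1) n φ (nab.twist ϕ)
      + ((n : ℂ) * (-i + m) / ((l + 1) * (i + k - 2 * m))) •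
          𝔖.prod (m + 1) (n - 1) φ (nab.curl ϕ)
      + (((k : ℂ) - m) * (i + k - m + 1) / ((k + 1) * (i + k - 2 * m))) •
          𝔖.prod m n φ (nab.curlDagger ϕ)
      + ((n : ℂ) * (k - m) * (i + k - m + 1) / ((k + 1) * (l + 1) * (i + k - 2 * m))) •
          𝔖.prod m (n - 1) φ (nab.div ϕ)) ∧
    -- `𝒟 (φ ⊙^{m,n} ϕ)`, where the product has at least one index of each kind
    (2 * m < i + k → 2 * n < j + l →
      nab.div (𝔖.prod m n φ ϕ : SymSpin.RawField S p q) =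
        ((-1 : ℂ) ^ (m + n) * (k - m) * (l - n) / ((i + k - 2 * m) * (j + l - 2 * n))) •
          𝔖.prod (m + 1) (n + 1) ϕ (nab.twist φ)
      + ((-1 : ℂ) ^ (m + n + 1) * (j - n) * (k - m) * (j + l - n + 1) /
            ((j + 1) * (i + k - 2 * m) * (j + l - 2 * n))) •
          𝔖.prod (m + 1) n ϕ (nab.curl φ)
      + ((-1 : ℂ) ^ (m + n + 1) * (i - m) * (l - n) * (i + k - m + 1) /
            ((i + 1) * (i + k - 2 * m) * (j + l - 2 * n))) •
          𝔖.prod m (n + 1) ϕ (nab.curlDagger φ)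
      + ((-1 : ℂ) ^ (m + n) * (i - m) * (j - n) * (i + k - m + 1) * (j + l - n + 1) /
            ((i + 1) * (j + 1) * (i + k - 2 * m) * (j + l - 2 * n))) •
          𝔖.prod m n ϕ (nab.div φ)
      + (((i : ℂ) - m) * (j - n) / ((i + k - 2 * m) * (j + l - 2 * n))) •
          𝔖.prod (m + 1) (n + 1) φ (nab.twist ϕ)
      + ((-i + m : ℂ) * (l - n) * (j + l - n + 1) /
            ((l + 1) * (i + k - 2 * m) * (j + l - 2 * n))) •
          𝔖.prod (m + 1) n φ (nab.curl ϕ)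
      + (((j : ℂ) - n) * (-k + m) * (i + k - m + 1) /
            ((k + 1) * (i + k - 2 * m) * (j + l - 2 * n))) •
          𝔖.prod m (n + 1) φ (nab.curlDagger ϕ)
      + (((k : ℂ) - m) * (l - n) * (i + k - m + 1) * (j + l - n + 1) /
            ((k + 1) * (l + 1) * (i + k - 2 * m) * (j + l - 2 * n))) •
          𝔖.prod m n φ (nab.div ϕ)) := by
  have hp' : p + 2 * m = i + k := by omega
  have hq' : q + 2 * n = j + l := by omega
  have hfac : (k : ℂ) * l + k + l + 1 = (k + 1) * (l + 1) := by ring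
  have zU := SymSpin.powerLeibniz_zero hmi hmk hp'
  have zV := SymSpin.powerLeibniz_zero hnj hnl hq'
  -- The same identities with `i, k` and `j, l` exchanged serve the terms in which the second factor
  -- is differentiated.
  have zW := SymSpin.powerLeibniz_zero hmk hmi (hp'.trans (add_comm i k))
  have zZ := SymSpin.powerLeibniz_zero hnl hnj (hq'.trans (add_comm j l))
  -- A further contraction with `∇` needs a free index of that kind in the product; this also keeps
  -- `p - 1` from being truncated.
  have oU := fun h : 2 * m < i + k => SymSpin.powerLeibniz_one hmi hmk hp' (by omega)
  have oV := fun h : 2 * n < j + l => SymSpin.powerLeibniz_one hnj hnl hq' (by omega)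
  have oW := fun h : 2 * m < i + k =>
    SymSpin.powerLeibniz_one hmk hmi (hp'.trans (add_comm i k)) (by omega)
  have oZ := fun h : 2 * n < j + l =>
    SymSpin.powerLeibniz_one hnl hnj (hq'.trans (add_comm j l)) (by omega)
  refine ⟨?_, fun hn => ?_, fun hm => ?_, fun hm hn => ?_⟩
  -- The fifth coefficient is made explicit, and the last denominator is split into its unprimed and
  -- primed factors.
  · rw [← one_smul ℂ (𝔖.prod m n φ (nab.twist ϕ)), hfac]
    refine nab.nablaProd_prod hφ hϕ zU zV zW zZ ?_ ?_ ?_ ?_ ?_ ?_ ?_ ?_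
    -- Only the parities of `m` and `n` matter. When the second factor is differentiated, the sign
    -- from exchanging the factors cancels the `(-1)^m` and `(-1)^n` of the one-kind identities.
    all_goals
      rcases neg_one_pow_eq_or ℂ m with h | h <;> rcases neg_one_pow_eq_or ℂ n with h' | h' <;>
      simp only [pow_add, h, h', div_eq_mul_inv, mul_inv] <;> ring
  -- The subtracted fifth term is turned into a term with negative coefficient; its minus sign is
  -- the extra sign in `(-1)^(n+1)`.
  · rw [sub_eq_add_neg, ← neg_smul]
    refine nab.nablaProd_prod hφ hϕ zU (oV hn) zW (oZ hn) ?_ ?_ ?_ ?_ ?_ ?_ ?_ ?_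
    all_goals
      rcases neg_one_pow_eq_or ℂ m with h | h <;> rcases neg_one_pow_eq_or ℂ n with h' | h' <;>
      simp only [pow_add, h, h', div_eq_mul_inv, mul_inv] <;> ring
  · rw [sub_eq_add_neg, ← neg_smul]
    refine nab.nablaProd_prod hφ hϕ (oU hm) zV (oW hm) zZ ?_ ?_ ?_ ?_ ?_ ?_ ?_ ?_
    all_goals
      rcases neg_one_pow_eq_or ℂ m with h | h <;> rcases neg_one_pow_eq_or ℂ n with h' | h' <;>
      simp only [pow_add, h, h', div_eq_mul_inv, mul_inv] <;> ring
  · refine nab.nablaProd_prod hφ hϕ (oU hm) (oV hn) (oW hm) (oZ hn) ?_ ?_ ?_ ?_ ?_ ?_ ?_ ?_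
    all_goals
      rcases neg_one_pow_eq_or ℂ m with h | h <;> rcases neg_one_pow_eq_or ℂ n with h' | h' <;>
      simp only [pow_add, h, h', div_eq_mul_inv, mul_inv] <;> ring
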